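/- Let $q$ be a power of a prime, let $n\ge 2$, let $r$ be an integer with $n/2\le r\le n-1$ and $\gcd(n,r)=1$, and let $1\le s<n-1$. A $q$-polynomial over $\mathbb F_{q^n}$ is a polynomial all of whose monomials have the form $a\,y^{q^i}$ with $i\ge 0$. Put $T_n(y)=y+y^q+\cdots+y^{q^{n-1}}$. Let $g_s\in\mathbb F_{q^n}[y]$ be a monic $q$-polynomial of degree $q^s$ that splits into linear factors over $\mathbb F_{q^n}$ and satisfies $g_s(g(y))=T_n(y)$ for some monic $q$-polynomial $g\in\mathbb F_{q^n}[y]$. Let $\mathcal X_{n,r}^s$ be the curve over $\mathbb F_{q^n}$ with affine equation $$g_s(y)=x^{q^n+q^{n-r}}-x^{q^{n-r}+1}.$$ Then: 1. The total ring of fractions $\mathbb F_{q^n}(\mathcal X_{n,r}^s)$ of $\mathbb F_{q^n}[x,y]/(g_s(y)-x^{q^n+q^{n-r}}+x^{q^{n-r}+1})$ is a field, and it has exactly one place $P_\infty$ centred at the point $(0:1:0)$ of the projective closure of $\mathcal X_{n,r}^s$. 2. There are unique $q$-polynomials $Q,U\in\mathbb F_{q^n}[y]$ and a unique integer $u$ with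 $$Q(y)^{q^{n-r}}=y+U(g_s(y)),\qquad \deg U=q^u,\qquad 0\le u\le n-r-1,$$ and there is a unique polynomial $h\in\mathbb F_{q^n}[x]$ with $h(x)^{q^{n-r}}=U(x^{q^n+q^{n-r}})$. 3. The pole divisor of the function $Z:=Q(y)-h(x)\in\mathbb F_{q^n}(\mathcal X_{n,r}^s)$ is $$(Z)_\infty=\begin{cases}(q^r+1)\,P_\infty & \text{if } s\le r-u-1,\\ q^{s+u+r-n}(q^{n-r}+1)\,P_\infty & \text{if } s\ge r-u.\end{cases}$$ In particular, $$(Z)_\infty=\begin{cases}(q^r+1)\,P_\infty & \text{if } s\le 2r-n,\\ (q^n+q^r)\,P_\infty & \text{if } s\ge r+1.\end{cases}$$ -/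

import Mathlib

open Polynomial
open scoped WithZero

namespace SubcoverXnr

noncomputable section

/-- `f` is a `q`-polynomial (linearized polynomial): only the monomials `X ^ (q ^ j)` occur in it. -/
def IsQPoly {k : Type*} [Field k] (q : ℕ) (f : k[X]) : Prop :=
  ∀ i : ℕ, f.coeff i ≠ 0 → ∃ j : ℕ, i = q ^ j

/-- The polynomial `T_n(z) = z + z^q + ⋯ + z^(q^(n-1))`. -/
def traceT (k : Type*) [Field k] (q n : ℕ) : k[X] :=
  ∑ i ∈ Finset.range n, (X : k[X]) ^ (q ^ i)

/-- `gs` is a monic `q`-polynomial of degree `q^s` that splits into linear factors over `k` and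
satisfies `gs(g(y)) = T_n(y)` for some monic `q`-polynomial `g` over `k`. -/
structure IsCoverPoly {k : Type*} [Field k] (q n s : ℕ) (gs : k[X]) : Prop where
  qpoly : IsQPoly q gs
  monic : gs.Monic
  natDegree_eq : gs.natDegree = q ^ s
  splits : gs.Splits
  comp_eq : ∃ g : k[X], IsQPoly q g ∧ g.Monic ∧ gs.comp g = traceT k q n

/-! ### The curve `gs(y) = x^(q^n + q^(n-r)) - x^(q^(n-r) + 1)` -/

/-- The defining polynomial `gs(y) - (x^(q^n + q^(n-r)) - x^(q^(n-r) + 1))` in `k[x][y]`: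
the inner variable is `x`, the outer one is `y`. -/
def curvePoly {k : Type*} [Field k] (q n r : ℕ) (gs : k[X]) : k[X][X] :=
  gs.map C - C ((X : k[X]) ^ (q ^ n + q ^ (n - r)) - X ^ (q ^ (n - r) + 1))

/-- The coordinate ring `k[x, y]` of the affine plane curve. -/
abbrev CoordRing {k : Type*} [Field k] (q n r : ℕ) (gs : k[X]) : Type _ :=
  AdjoinRoot (curvePoly q n r gs)

/-- The function field of the curve, the fraction field of the coordinate ring. (For an arbitrary
`gs` this is the total ring of fractions.) -/
abbrev FunField {k : Type*} [Field k] (q n r : ℕ) (gs : k[X]) : Type _ :=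
  FractionRing (CoordRing q n r gs)

/-- The coordinate function `x`. -/
def xFun {k : Type*} [Field k] (q n r : ℕ) (gs : k[X]) : FunField q n r gs :=
  algebraMap (CoordRing q n r gs) (FunField q n r gs) (AdjoinRoot.of (curvePoly q n r gs) X)

/-- The coordinate function `y`. -/
def yFun {k : Type*} [Field k] (q n r : ℕ) (gs : k[X]) : FunField q n r gs :=
  algebraMap (CoordRing q n r gs) (FunField q n r gs) (AdjoinRoot.root (curvePoly q n r gs))

/-! ### Places and pole divisors -/

/-- A place of the function field `E` over `k`, given by its normalized discrete valuation: a
surjective valuation `E → ℤᵐ⁰` which is trivial on the constants. In multiplicative notation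
`val f = exp (-v_P(f))`. -/
structure Place (k E : Type*) [Field k] [CommRing E] [Algebra k E] where
  val : Valuation E ℤᵐ⁰
  surjective : Function.Surjective val
  trivial_on_const : ∀ c : k, c ≠ 0 → val (algebraMap k E c) = 1

/-- The order `v_P(f)` of `f ≠ 0` at `P` (with the value `0` for `f = 0`). -/
def Place.ord {k E : Type*} [Field k] [CommRing E] [Algebra k E] (P : Place k E) (f : E) : ℤ :=
  -WithZero.log (P.val f)

/-- The pole divisor `(f)_∞ = ∑_P max(0, -v_P(f)) P`, as the function of its coefficients. -/
def poleDivisor (k : Type*) {E : Type*} [Field k] [CommRing E] [Algebra k E] (f : E) :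
    Place k E → ℤ :=
  fun P => max 0 (-P.ord f)

/-- The place `P` is centred at the point `(0 : 1 : 0)` of the projective closure of the curve:
both `x/y` and `1/y` vanish at `P`. -/
def IsAtInfinity {k : Type*} [Field k] (q n r : ℕ) (gs : k[X])
    (P : Place k (FunField q n r gs)) : Prop :=
  P.val (xFun q n r gs) < P.val (yFun q n r gs) ∧ 1 < P.val (yFun q n r gs)

/-! ### The polynomials `Q`, `U`, `h` and the function `Z` -/

/-- `Q` and `U` are `q`-polynomials with `Q(y)^(q^(n-r)) = y + U(gs(y))`, and `U` has degree `q^u`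
with `u ≤ n - r - 1`. -/
structure IsKeyTriple {k : Type*} [Field k] (q n r : ℕ) (gs Q U : k[X]) (u : ℕ) : Prop where
  qpoly_Q : IsQPoly q Q
  qpoly_U : IsQPoly q U
  eq : Q ^ (q ^ (n - r)) = X + U.comp gs
  natDegree_U : U.natDegree = q ^ u
  u_le : u ≤ n - r - 1

/-- `h(x)^(q^(n-r)) = U(x^(q^n + q^(n-r)))`. -/
def IsRootPoly {k : Type*} [Field k] (q n r : ℕ) (U h : k[X]) : Prop :=
  h ^ (q ^ (n - r)) = U.comp (X ^ (q ^ n + q ^ (n - r)))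

/-- The function `Z = Q(y) - h(x)` on the curve. -/
def zFun {k : Type*} [Field k] (q n r : ℕ) (gs Q h : k[X]) : FunField q n r gs :=
  aeval (yFun q n r gs) Q - aeval (xFun q n r gs) h

end

end SubcoverXnr

/-! Put h = g(X^q - X). Since T_n(X^q - X) telescopes, gs∘h = X^(q^n) - X. This polynomial commutes
with q-polynomials over F_(q^n), so h∘gs = X^(q^n) - X as well. Splitting h at degree q^(n-r) into a
low part U and a q^(n-r)-th power turns the second identity into the equation for Q; the first one
forces U to be this low part (`IsKeyTriple.coeff_U`).

The behaviour at infinity is read off in Hahn series in t = 1/x with rational exponents. Let F be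
the right-hand side of the curve equation. An explicit series S solves S^(q^n) - S = F, so Y = h(S)
satisfies gs(Y) = F. If Y had degree less than q^s over the Laurent series, its conjugates would be
its translates by a proper subgroup W of the kernel of gs, and M(h(S)) would be a Laurent series,
where M is the monic polynomial with simple roots W. But M∘h is additive of degree less than q^n
with nonzero linear coefficient, so the non-integral exponent -(q^(n-r)+1)/q^n survives in M(h(S))
(`natDegree_minpoly`). Hence the curve polynomial is irreducible even over the Laurent series. The
residue field cannot grow inside Hahn series over k, so the extension is totally ramified
(`order_of_finrank`), and x has a single pole, of order q^s (`exists_unique_place`).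

Finally Z^(q^(n-r)) = y - U(x^(q^(n-r)+1)) (`IsKeyTriple.pow_eq`). At P_∞ the two terms have pole
orders q^n + q^(n-r) and q^(s+u) (q^(n-r)+1). These differ because n-r < r, and the larger one
decides. At every other place x and y are integral, hence so is Z. -/

namespace SubcoverXnr

/-! ### Additive polynomials and Frobenius powers -/

section QPoly

variable {k : Type*} [Field k] {p e q : ℕ} [Fact p.Prime] [CharP k p]

theorem IsQPoly.coeff_zero {f : k[X]} (hf : IsQPoly q f) (hq : 0 < q) : f.coeff 0 = 0 := by
  by_contra h
  obtain ⟨j, hj⟩ := hf 0 h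
  exact (pow_pos hq j).ne hj

theorem IsQPoly.aeval_add (hq : q = p ^ e) {f : k[X]} (hf : IsQPoly q f)
    {A : Type*} [CommRing A] [Algebra k A] [CharP A p] (a b : A) :
    aeval (a + b) f = aeval a f + aeval b f := by
  simp only [aeval_eq_sum_range, ← Finset.sum_add_distrib]
  refine Finset.sum_congr rfl fun i _ => ?_
  by_cases h : f.coeff i = 0
  · simp [h]
  · obtain ⟨j, rfl⟩ := hf i h
    rw [hq, ← pow_mul, add_pow_char_pow, smul_add]

theorem IsQPoly.aeval_sub (hq : q = p ^ e) {f : k[X]} (hf : IsQPoly q f)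
    {A : Type*} [CommRing A] [Algebra k A] [CharP A p] (a b : A) :
    aeval (a - b) f = aeval a f - aeval b f := by
  have := hf.aeval_add hq (a - b) b
  rw [sub_add_cancel] at this
  rw [this, add_sub_cancel_right]

theorem coeff_pow_char_pow (f : k[X]) (m i : ℕ) :
    (f ^ (p ^ m)).coeff i = if p ^ m ∣ i then (f.coeff (i / p ^ m)) ^ p ^ m else 0 := by
  have hp : 0 < p := (Fact.out : p.Prime).pos
  rw [← map_iterateFrobenius_expand, coeff_map, coeff_expand (pow_pos hp m)]
  split_ifs
  · rw [iterateFrobenius_def]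
  · simp

theorem IsQPoly.pow (hq : q = p ^ e) {f : k[X]} (hf : IsQPoly q f) (j : ℕ) :
    IsQPoly q (f ^ q ^ j) := by
  intro i hi
  rw [hq, ← pow_mul, coeff_pow_char_pow] at hi
  split_ifs at hi with h
  · obtain ⟨l, hl⟩ := hf _ (fun h0 => hi (by
      rw [h0, zero_pow (pow_ne_zero _ (Fact.out : p.Prime).ne_zero)]))
    refine ⟨l + j, ?_⟩
    rw [pow_mul, ← hq] at h hl
    rw [pow_add, ← hl, Nat.div_mul_cancel h]
  · exact absurd rfl hi

theorem IsQPoly.add {f g : k[X]} (hf : IsQPoly q f) (hg : IsQPoly q g) : IsQPoly q (f + g) := by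
  intro i hi
  by_cases h : f.coeff i = 0
  · exact hg i (by simpa [h] using hi)
  · exact hf i h

theorem isQPoly_X : IsQPoly q (X : k[X]) := by
  intro i hi
  rw [coeff_X] at hi
  exact ⟨0, by simpa using (ite_ne_right_iff.1 hi).1.symm⟩

theorem IsQPoly.comp (hq : q = p ^ e) {f g : k[X]} (hf : IsQPoly q f) (hg : IsQPoly q g) :
    IsQPoly q (f.comp g) := by
  intro i hi
  rw [comp_eq_sum_left, sum_def, finsetSum_coeff] at hi
  obtain ⟨l, hl, hl'⟩ := Finset.exists_ne_zero_of_sum_ne_zero hi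
  rw [coeff_C_mul] at hl'
  obtain ⟨j, rfl⟩ := hf l (left_ne_zero_of_mul hl')
  exact hg.pow hq j i (right_ne_zero_of_mul hl')

theorem pow_char_pow_injective (m : ℕ) : Function.Injective fun f : k[X] => f ^ p ^ m := by
  intro f g h
  exact iterateFrobenius_inj k[X] p m (by simpa [iterateFrobenius_def] using h)

/-- A finite field is perfect, so the inverse Frobenius extracts the roots of the coefficients. -/
theorem exists_pow_char_pow_eq [Finite k] (m : ℕ) (f : k[X])
    (hf : ∀ i, f.coeff i ≠ 0 → p ^ m ∣ i) : ∃ g : k[X], g ^ p ^ m = f := by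
  have hp : 0 < p := (Fact.out : p.Prime).pos
  refine ⟨(contract (p ^ m) f).map (iterateFrobeniusEquiv k p m).symm.toRingHom, ?_⟩
  ext i
  rw [coeff_pow_char_pow]
  split_ifs with h
  · rw [coeff_map, coeff_contract (pow_pos hp m).ne', Nat.div_mul_cancel h]
    have := (iterateFrobeniusEquiv k p m).apply_symm_apply (f.coeff i)
    rwa [iterateFrobeniusEquiv_def] at this
  · by_contra h'
    exact h (hf i (Ne.symm h'))

theorem IsQPoly.of_pow (hq : q = p ^ e) (hq1 : 1 < q) {f : k[X]} {m : ℕ}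
    (hf : IsQPoly q (f ^ q ^ m)) : IsQPoly q f := by
  intro i hi
  have hqm : 0 < q ^ m := pow_pos (by omega) m
  obtain ⟨j, hj⟩ := hf (i * q ^ m) (by
    rw [hq, ← pow_mul, coeff_pow_char_pow, pow_mul, ← hq, if_pos (dvd_mul_left _ _),
      Nat.mul_div_cancel _ hqm]
    exact pow_ne_zero _ hi)
  have hi0 : i ≠ 0 := by
    rintro rfl
    rw [zero_mul] at hj
    exact (pow_pos (by omega : 0 < q) j).ne hj
  have hmj : m ≤ j := by
    rw [← Nat.pow_le_pow_iff_right hq1, ← hj]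
    exact Nat.le_mul_of_pos_left _ (Nat.pos_of_ne_zero hi0)
  refine ⟨j - m, Nat.eq_of_mul_eq_mul_right hqm ?_⟩
  rw [hj, ← pow_add, Nat.sub_add_cancel hmj]

/-- An additive polynomial has only monomials of `p`-power degree. -/
theorem exists_pow_of_additive {K : Type*} [Field K] [Infinite K] [Algebra k K] {f : k[X]}
    (hf : ∀ a b : K, aeval (a + b) f = aeval a f + aeval b f) {i : ℕ} (hi : f.coeff i ≠ 0) :
    ∃ j, i = p ^ j := by
  have hp : p.Prime := Fact.out
  have : CharP K p := charP_of_injective_algebraMap (algebraMap k K).injective p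
  -- Additivity says F(X + b) = F + F(b), so every Hasse derivative of order m ≥ 1 is constant. Its
  -- coefficient at X^(i-m) is binom(i, m) times that of F at X^i.
  have key : ∀ m, 1 ≤ m → m < i → ((i.choose m : ℕ) : k) = 0 := by
    intro m hm hmi
    set F := f.map (algebraMap k K) with hF
    have h1 : ∀ b : K, (hasseDeriv m F).eval b = F.coeff m := by
      intro b
      rw [← taylor_coeff]
      have : taylor b F = F + C (F.eval b) := by
        refine Polynomial.funext fun a => ?_
        have := hf a b
        simpa [hF, taylor_eval, eval_map_algebraMap] using this
      rw [this, coeff_add, coeff_C_of_ne_zero (by omega), add_zero]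
    have h2 : hasseDeriv m F = C (F.coeff m) :=
      Polynomial.funext fun b => by rw [h1, eval_C]
    have h3 := congrArg (fun g => coeff g (i - m)) h2
    simp only [hasseDeriv_coeff, coeff_C_of_ne_zero (show i - m ≠ 0 by omega),
      Nat.sub_add_cancel hmi.le, hF, coeff_map] at h3
    have h4 : ((i.choose m : ℕ) : K) = 0 := by
      refine (mul_eq_zero.1 h3).resolve_right ?_
      simpa using hi
    rw [← map_natCast (algebraMap k K)] at h4
    exact (map_eq_zero _).1 h4
  have h0 : i ≠ 0 := by
    rintro rfl
    have := hf 0 0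
    rw [add_zero] at this
    have h' : aeval (0 : K) f = 0 := by
      have := this
      simpa using this
    rw [← coeff_zero_eq_aeval_zero'] at h'
    exact hi (by simpa using h')
  obtain ⟨v, m, hm, rfl⟩ := Nat.exists_eq_pow_mul_and_not_dvd h0 p hp.ne_one
  by_cases hm1 : m = 1
  · exact ⟨v, by simp [hm1]⟩
  exfalso
  have hm0 : m ≠ 0 := by rintro rfl; simp at hm
  have hpv : 0 < p ^ v := pow_pos hp.pos v
  have h := key (p ^ v) hpv (by nlinarith [show 2 ≤ m by omega])
  -- This is binom(p^v m, p^v) ≡ m mod p, which is nonzero and contradicts `key` at p^v.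
  have hc : (((1 + X : k[X]) ^ (p ^ v * m)).coeff (p ^ v)) = (m : k) := by
    rw [mul_comm, pow_mul, coeff_pow_char_pow, if_pos dvd_rfl, Nat.div_self hpv,
      coeff_one_add_X_pow, Nat.choose_one_right, ← iterateFrobenius_def, map_natCast]
  rw [coeff_one_add_X_pow] at hc
  rw [hc] at h
  exact hm ((CharP.cast_eq_zero_iff k p m).1 h)

end QPoly

/-! ### Existence and uniqueness of Q, U, u and h -/

section KeyTriple

variable {k : Type*} [Field k] {p e q n r s : ℕ} [Fact p.Prime] [CharP k p]

/-- T_n(X^q - X) is a telescoping sum. -/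
theorem comp_comp_X_pow_sub_X {gs g : k[X]} (hq : q = p ^ e)
    (hg : gs.comp g = traceT k q n) : gs.comp (g.comp (X ^ q - X)) = X ^ q ^ n - X := by
  rw [← comp_assoc, hg, traceT, sum_comp]
  have : ∀ i, ((X : k[X]) ^ q ^ i).comp (X ^ q - X) = X ^ q ^ (i + 1) - X ^ q ^ i := by
    intro i
    rw [pow_comp, X_comp, hq, ← pow_mul, sub_pow_char_pow, ← pow_mul, ← pow_add,
      ← pow_mul, Nat.mul_succ, add_comm e]
  simp_rw [this]
  rw [Finset.sum_range_sub (fun i => (X : k[X]) ^ q ^ i)]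
  simp

theorem isQPoly_X_pow_sub_X : IsQPoly q (X ^ q - X : k[X]) := by
  intro i hi
  by_cases h1 : i = 1
  · exact ⟨0, by simpa using h1⟩
  · refine ⟨1, ?_⟩
    rw [coeff_sub, coeff_X_of_ne_one h1, sub_zero, coeff_X_pow] at hi
    simpa using (ite_ne_right_iff.1 hi).1

/-- A right inverse of `gs` modulo the central element `X ^ (q ^ n) - X` is a left inverse. -/
theorem comp_eq_of_comp_eq [Fintype k] (hq : q = p ^ e) (hq1 : 1 < q)
    (hk : Fintype.card k = q ^ n) {gs h : k[X]} (hgs : IsQPoly q gs) (hgs0 : 0 < gs.natDegree)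
    (hh : IsQPoly q h) (hcomp : gs.comp h = X ^ q ^ n - X) : h.comp gs = X ^ q ^ n - X := by
  have hq0 : 0 < q := by omega
  have h1 : gs.comp (h.comp gs) = gs ^ q ^ n - gs := by
    rw [← comp_assoc, hcomp]; simp
  -- The coefficients of gs are fixed by the q^n-th power map. Thus gs kills the difference of the
  -- two sides of the claim, which must then be a constant, and q-polynomials have no constant term.
  have h2 : gs.comp (X ^ q ^ n) = gs ^ q ^ n := by
    rw [← hk, ← expand_eq_comp_X_pow, FiniteField.expand_card]
  have h3 : gs.comp (h.comp gs - (X ^ q ^ n - X)) = 0 := by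
    have ha := hgs.aeval_sub hq (h.comp gs) (X ^ q ^ n - X)
    have hb := hgs.aeval_sub hq ((X : k[X]) ^ q ^ n) X
    rw [← comp_eq_aeval, ← comp_eq_aeval, ← comp_eq_aeval] at ha hb
    rw [ha, hb, h1, h2, comp_X, sub_self]
  have h4 : (h.comp gs - (X ^ q ^ n - X)).natDegree = 0 := by
    have := congrArg natDegree h3
    rw [natDegree_comp, natDegree_zero] at this
    exact (Nat.mul_eq_zero.1 this).resolve_left hgs0.ne'
  have h5 := eq_C_of_natDegree_eq_zero h4
  have h6 : (h.comp gs - (X ^ q ^ n - X)).coeff 0 = 0 := by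
    have h7 := (hh.comp hq hgs).coeff_zero hq0
    have h8 : q ^ n ≠ 0 := (pow_pos hq0 n).ne'
    rw [coeff_sub, h7, coeff_sub, coeff_X_zero, coeff_X_pow, if_neg h8.symm]
    simp
  rw [h6, C_0] at h5
  exact sub_eq_zero.1 h5

/-- Substituting h into the equation for Q gives Q(h)^(q^(n-r)) = h - U + U(X^(q^n)). The left side
and the last term only involve exponents divisible by q^(n-r), so h and U agree below that degree.
This makes U, and then Q and u, unique. -/
theorem IsKeyTriple.coeff_U (hq : q = p ^ e) (hq1 : 1 < q) (hrn : r < n)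
    {gs h Q U : k[X]} {u : ℕ} (hh : IsQPoly q h)
    (hcomp : gs.comp h = X ^ q ^ n - X) (ht : IsKeyTriple q n r gs Q U u) (i : ℕ) :
    U.coeff i = if i < q ^ (n - r) then h.coeff i else 0 := by
  have hq0 : 0 < q := by omega
  have hU0 := ht.qpoly_U.coeff_zero hq0
  split_ifs with hi
  · have h1 : (Q.comp h) ^ q ^ (n - r) = h + (U.comp (X ^ q ^ n) - U) := by
      have := congrArg (fun f => f.comp h) ht.eq
      simp only [pow_comp, add_comp, X_comp, comp_assoc, hcomp] at this
      rw [this]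
      have hb := ht.qpoly_U.aeval_sub hq ((X : k[X]) ^ q ^ n) X
      rw [← comp_eq_aeval, ← comp_eq_aeval, ← comp_eq_aeval, comp_X] at hb
      rw [hb]
    by_cases hi0 : i = 0
    · rw [hi0, hU0, hh.coeff_zero hq0]
    · have := congrArg (fun f => coeff f i) h1
      have hnd : ¬ q ^ (n - r) ∣ i := fun hd => by
        have := Nat.le_of_dvd (Nat.pos_of_ne_zero hi0) hd
        omega
      have hnd' : ¬ q ^ n ∣ i := fun hd =>
        hnd ((pow_dvd_pow q (Nat.sub_le n r)).trans hd)
      rw [← expand_eq_comp_X_pow, hq, ← pow_mul, coeff_pow_char_pow, pow_mul, ← hq,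
        if_neg hnd, coeff_add, coeff_sub, coeff_expand (pow_pos hq0 n), if_neg hnd',
        zero_sub] at this
      linear_combination this
  · refine coeff_eq_zero_of_natDegree_lt ?_
    rw [ht.natDegree_U]
    have := ht.u_le
    exact lt_of_lt_of_le (Nat.pow_lt_pow_right hq1 (by omega)) (not_lt.1 hi)

theorem IsKeyTriple.ext (hq : q = p ^ e) (hq1 : 1 < q) (hrn : r < n)
    {gs h Q U Q' U' : k[X]} {u u' : ℕ} (hh : IsQPoly q h)
    (hcomp : gs.comp h = X ^ q ^ n - X) (ht : IsKeyTriple q n r gs Q U u)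
    (ht' : IsKeyTriple q n r gs Q' U' u') : Q = Q' ∧ U = U' ∧ u = u' := by
  have hU : U = U' := by
    ext i
    rw [ht.coeff_U hq hq1 hrn hh hcomp, ht'.coeff_U hq hq1 hrn hh hcomp]
  subst hU
  refine ⟨pow_char_pow_injective (p := p) (e * (n - r)) ?_, rfl, ?_⟩
  · simp only [pow_mul, ← hq]
    rw [ht.eq, ht'.eq]
  · exact Nat.pow_right_injective hq1 (ht.natDegree_U.symm.trans ht'.natDegree_U)

/-- The chain rule at 0. -/
theorem coeff_one_comp {f g : k[X]} (hg : g.coeff 0 = 0) :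
    (f.comp g).coeff 1 = f.coeff 1 * g.coeff 1 := by
  have h : ∀ f : k[X], f.coeff 1 = (derivative f).eval 0 := fun f => by
    rw [← coeff_zero_eq_eval_zero, coeff_derivative]; simp
  rw [h, h f, h g, derivative_comp, eval_mul, eval_comp, ← coeff_zero_eq_eval_zero (p := g), hg,
    mul_comm]

theorem IsQPoly.exists_natDegree_eq {f : k[X]} (hf : IsQPoly q f) (h0 : f ≠ 0) :
    ∃ j, f.natDegree = q ^ j :=
  hf _ (leadingCoeff_ne_zero.2 h0)

/-- Truncate h below degree q^(n-r) to get U. The rest of h is R^(q^(n-r)), and h∘gs = X^(q^n) - X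
becomes X + U(gs) = (X^(q^r) - R(gs))^(q^(n-r)). -/
theorem exists_isKeyTriple [Finite k] (hq : q = p ^ e) (hq1 : 1 < q) (hrn : r < n)
    {gs h : k[X]} (hgs : IsQPoly q gs) (hh : IsQPoly q h) (hh1 : h.coeff 1 ≠ 0)
    (hcomp : h.comp gs = X ^ q ^ n - X) : ∃ Q U u, IsKeyTriple q n r gs Q U u := by
  have hq0 : 0 < q := by omega
  set U : k[X] := ∑ i ∈ Finset.range (q ^ (n - r)), monomial i (h.coeff i) with hUdef
  have hU : ∀ i, U.coeff i = if i < q ^ (n - r) then h.coeff i else 0 := by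
    intro i
    simp [hUdef, finsetSum_coeff, coeff_monomial]
  have hUq : IsQPoly q U := fun i hi => hh i (by
    rw [hU] at hi
    exact (ite_ne_right_iff.1 hi).2)
  have hU0 : U ≠ 0 := fun h0 => hh1 (by
    have := hU 1
    rwa [h0, coeff_zero, if_pos (Nat.one_lt_pow (by omega) hq1), eq_comm] at this)
  obtain ⟨u, hu⟩ := hUq.exists_natDegree_eq hU0
  have hu_lt : u < n - r := by
    have h1 : U.coeff U.natDegree ≠ 0 := leadingCoeff_ne_zero.2 hU0
    rw [hU, hu] at h1
    exact (Nat.pow_lt_pow_iff_right hq1).1 (ite_ne_right_iff.1 h1).1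
  obtain ⟨R, hR⟩ := exists_pow_char_pow_eq (p := p) (e * (n - r)) (h - U) (by
    intro i hi
    rw [coeff_sub, hU] at hi
    split_ifs at hi with hlt
    · simp at hi
    · rw [sub_zero] at hi
      obtain ⟨j, rfl⟩ := hh i hi
      rw [pow_mul, ← hq]
      exact pow_dvd_pow q ((Nat.pow_le_pow_iff_right hq1).1 (not_lt.1 hlt)))
  have hQ : (X ^ q ^ r - R.comp gs) ^ q ^ (n - r) = X + U.comp gs := by
    have h1 : (R.comp gs) ^ q ^ (n - r) = h.comp gs - U.comp gs := by
      rw [← pow_comp, hq, ← pow_mul, hR, sub_comp]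
    have h2 : ((X : k[X]) ^ q ^ r) ^ q ^ (n - r) = X ^ q ^ n := by
      rw [← pow_mul, ← pow_add, Nat.add_sub_cancel' hrn.le]
    have h3 := sub_pow_char_pow (X ^ q ^ r) (R.comp gs) (p := p) (n := e * (n - r))
    rw [pow_mul, ← hq] at h3
    rw [h3, h2, h1, hcomp]
    ring
  refine ⟨X ^ q ^ r - R.comp gs, U, u, ?_, hUq, hQ, hu, by omega⟩
  refine IsQPoly.of_pow hq hq1 (m := n - r) ?_
  rw [hQ]
  exact isQPoly_X.add (hUq.comp hq hgs)

/-- For s > r the degree q^(n-s) of h is below q^(n-r), so the truncation U is h itself. -/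
theorem IsKeyTriple.u_eq (hq : q = p ^ e) (hq1 : 1 < q) (hrn : r < n)
    {gs h Q U : k[X]} {u : ℕ} (hh : IsQPoly q h) (hcomp : gs.comp h = X ^ q ^ n - X)
    (ht : IsKeyTriple q n r gs Q U u) (hdeg : h.natDegree = q ^ (n - s)) (hrs : r < s)
    (hsn : s < n) : u = n - s := by
  have hU : U = h := by
    ext i
    rw [ht.coeff_U hq hq1 hrn hh hcomp]
    split_ifs with hi
    · rfl
    · refine (coeff_eq_zero_of_natDegree_lt ?_).symm
      rw [hdeg]
      exact (Nat.pow_lt_pow_right hq1 (by omega)).trans_le (not_lt.1 hi)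
  refine Nat.pow_right_injective hq1 ?_
  change q ^ u = q ^ (n - s)
  rw [← ht.natDegree_U, hU, hdeg]

theorem existsUnique_isRootPoly [Finite k] (hq : q = p ^ e) (hq0 : 0 < q) (U : k[X]) :
    ∃! h : k[X], IsRootPoly q n r U h := by
  obtain ⟨h, hh⟩ := exists_pow_char_pow_eq (p := p) (e * (n - r))
    (U.comp (X ^ (q ^ n + q ^ (n - r)))) (by
      intro i hi
      rw [← expand_eq_comp_X_pow, coeff_expand (by positivity)] at hi
      refine Dvd.dvd.trans ?_ (ite_ne_right_iff.1 hi).1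
      rw [pow_mul, ← hq]
      exact (Nat.dvd_add_right (pow_dvd_pow q (Nat.sub_le n r))).2 dvd_rfl)
  rw [pow_mul, ← hq] at hh
  refine ⟨h, hh, fun h' hh' => pow_char_pow_injective (p := p) (e * (n - r)) ?_⟩
  simp only [pow_mul, ← hq]
  exact hh'.trans hh.symm

end KeyTriple

/-! ### Frobenius on Hahn series and an Artin-Schreier type equation -/

section HahnSeries

open HahnSeries

variable {k : Type*} [Field k]

/-- The coefficientwise algebra structure, preferred over the one that goes through power series. -/
noncomputable instance hahnSeriesAlgebra {Γ : Type*} [AddCommMonoid Γ] [PartialOrder Γ]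
    [IsOrderedCancelAddMonoid Γ] : Algebra k (HahnSeries Γ k) := HahnSeries.instAlgebra

theorem lt_of_mem_support_pow {f : HahnSeries ℚ k} {δ : ℚ} (hf : ∀ γ ∈ f.support, γ < δ) (m : ℕ) :
    ∀ γ ∈ (f ^ (m + 1)).support, γ < (m + 1) * δ := by
  induction m with
  | zero => simpa using hf
  | succ m ih =>
    intro γ hγ
    rw [pow_succ] at hγ
    obtain ⟨a, ha, b, hb, rfl⟩ := Set.mem_add.1 (support_mul_subset hγ)
    have h1 := ih a ha
    have h2 := hf b hb
    push_cast
    linarith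

theorem gt_of_mem_support_pow {f : HahnSeries ℚ k} {δ : ℚ} (hf : ∀ γ ∈ f.support, δ < γ) (m : ℕ) :
    ∀ γ ∈ (f ^ (m + 1)).support, (m + 1) * δ < γ := by
  induction m with
  | zero => simpa using hf
  | succ m ih =>
    intro γ hγ
    rw [pow_succ] at hγ
    obtain ⟨a, ha, b, hb, rfl⟩ := Set.mem_add.1 (support_mul_subset hγ)
    have h1 := ih a ha
    have h2 := hf b hb
    push_cast
    linarith

variable {p : ℕ} [CharP k p]

variable (k p) in
theorem charP_hahnSeries : CharP (HahnSeries ℚ k) p :=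
  charP_of_injective_algebraMap (algebraMap k (HahnSeries ℚ k)).injective p

variable [Fact p.Prime]

/-- Cut f at δ = γ/p into the part below δ, the part above δ and the term at δ. The p-th power is
additive, and the powers of the first two parts are supported strictly below and strictly above γ.
-/
theorem coeff_hahnSeries_pow_char (f : HahnSeries ℚ k) (γ : ℚ) :
    (f ^ p).coeff γ = (f.coeff (γ / p)) ^ p := by
  have := charP_hahnSeries k p
  have hp : p.Prime := Fact.out
  have hp0 : (p : ℚ) ≠ 0 := Nat.cast_ne_zero.2 hp.ne_zero
  obtain ⟨m, hm⟩ : ∃ m, p = m + 1 := ⟨p - 1, by have := hp.pos; omega⟩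
  have hm' : (m : ℚ) + 1 = p := by rw [hm]; push_cast; ring
  set δ := γ / p with hδ
  have hγ : γ = p * δ := by rw [hδ]; field_simp
  set a := truncLT δ f with ha
  set b := f - a - single δ (f.coeff δ) with hb
  have hf : f = a + b + single δ (f.coeff δ) := by rw [hb]; ring
  have ha' : ∀ x ∈ a.support, x < δ := by
    intro x hx
    by_contra h
    exact hx (coeff_truncLT_of_le (not_lt.1 h) f)
  have hb' : ∀ x ∈ b.support, δ < x := by
    intro x hx
    by_contra h
    apply hx
    rw [hb, HahnSeries.coeff_sub, HahnSeries.coeff_sub]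
    rcases (not_lt.1 h).lt_or_eq with h | h
    · rw [coeff_single_of_ne h.ne, ha, coeff_truncLT_of_lt h]; simp
    · rw [h, coeff_single_same, ha, coeff_truncLT_of_le le_rfl]; simp
  have h1 : (a ^ p).coeff γ = 0 := by
    by_contra h
    rw [hm] at h
    have := lt_of_mem_support_pow ha' m γ h
    rw [hm', ← hγ] at this
    exact this.false
  have h2 : (b ^ p).coeff γ = 0 := by
    by_contra h
    rw [hm] at h
    have := gt_of_mem_support_pow hb' m γ h
    rw [hm', ← hγ] at this
    exact this.false
  conv_lhs => rw [hf]
  rw [add_pow_char, add_pow_char, HahnSeries.coeff_add, HahnSeries.coeff_add, h1, h2, single_pow, nsmul_eq_mul, ← hγ,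
    coeff_single_same]
  simp

theorem coeff_hahnSeries_pow_char_pow (f : HahnSeries ℚ k) (j : ℕ) (γ : ℚ) :
    (f ^ p ^ j).coeff γ = (f.coeff (γ / p ^ j)) ^ p ^ j := by
  induction j generalizing γ with
  | zero => simp
  | succ j ih =>
    rw [pow_succ, pow_mul, coeff_hahnSeries_pow_char, ih, ← pow_mul, div_div, pow_succ (p : ℚ),
      mul_comm (p : ℚ)]

theorem coeff_hahnSeries_pow_of_eq {N a : ℕ} (hN : N = p ^ a) (f : HahnSeries ℚ k) (γ : ℚ) :
    (f ^ N).coeff γ = (f.coeff (γ / N)) ^ N := by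
  subst hN
  rw [coeff_hahnSeries_pow_char_pow, Nat.cast_pow]

/-- The exponents increase, so they form a well-ordered set. Their denominators may be unbounded,
which is why Hahn series are used rather than Puiseux series. -/
theorem strictMono_neg_div_pow {N : ℕ} (hN : 1 < N) {c : ℚ} (hc : 0 < c) :
    StrictMono fun l : ℕ => -c / (N : ℚ) ^ (l + 1) := by
  refine strictMono_nat_of_lt_succ fun l => ?_
  have hN' : (1 : ℚ) < N := by exact_mod_cast hN
  have h0 : (0 : ℚ) < N := by linarith
  rw [neg_div, neg_div, neg_lt_neg_iff, pow_succ (N : ℚ) (l + 1)]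
  gcongr
  nlinarith [pow_pos h0 (l + 1)]

variable (k) in
/-- The series `∑_{l ≥ 1} t ^ (-c / N ^ l)`. -/
noncomputable def geomSeries (N : ℕ) (hN : 1 < N) (c : ℚ) (hc : 0 < c) : HahnSeries ℚ k :=
  embDomain (OrderEmbedding.ofStrictMono _ (strictMono_neg_div_pow hN hc))
    (⟨fun _ => 1, Set.isPWO_of_wellQuasiOrderedLE _⟩ : HahnSeries ℕ k)

variable {N : ℕ} {hN : 1 < N} {c : ℚ} {hc : 0 < c}

theorem coeff_geomSeries_of_eq {γ : ℚ} (l : ℕ) (h : γ * N ^ (l + 1) = -c) :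
    (geomSeries k N hN c hc).coeff γ = 1 := by
  have hN' : (N : ℚ) ≠ 0 := by positivity
  have : γ = OrderEmbedding.ofStrictMono _ (strictMono_neg_div_pow hN hc) l :=
    (eq_div_iff (pow_ne_zero _ hN')).2 h
  rw [this, geomSeries, embDomain_coeff]

theorem coeff_geomSeries_of_ne {γ : ℚ} (h : ∀ l : ℕ, γ * N ^ (l + 1) ≠ -c) :
    (geomSeries k N hN c hc).coeff γ = 0 := by
  have hN' : (N : ℚ) ≠ 0 := by positivity
  refine embDomain_of_notMem_range ?_
  rintro ⟨l, hl⟩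
  exact h l ((eq_div_iff (pow_ne_zero _ hN')).1 hl.symm)

/-- The N-th power multiplies exponents by N, which shifts the sum by one index; only the new
leading term t^(-c) is left. -/
theorem geomSeries_pow_sub {f : ℕ} (hf : N = p ^ f) :
    geomSeries k N hN c hc ^ N - geomSeries k N hN c hc = single (-c) 1 := by
  have hN' : (N : ℚ) ≠ 0 := by positivity
  ext γ
  rw [HahnSeries.coeff_sub, coeff_hahnSeries_pow_of_eq hf]
  by_cases hγ : γ = -c
  · rw [hγ, coeff_single_same, coeff_geomSeries_of_eq 0 (by field_simp; simp), one_pow,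
      coeff_geomSeries_of_ne, sub_zero]
    intro l hl
    have hN2 : (1 : ℚ) < N := by exact_mod_cast hN
    have := one_lt_pow₀ hN2 (Nat.succ_ne_zero l)
    rw [Nat.succ_eq_add_one] at this
    nlinarith
  · rw [coeff_single_of_ne hγ]
    by_cases h : ∃ l : ℕ, γ * N ^ (l + 1) = -c
    · obtain ⟨l, hl⟩ := h
      rw [coeff_geomSeries_of_eq l hl, coeff_geomSeries_of_eq (l + 1), one_pow, sub_self]
      rw [← hl, pow_succ (N : ℚ) (l + 1)]
      field_simp
    · push Not at h
      rw [coeff_geomSeries_of_ne h, coeff_geomSeries_of_ne, zero_pow (by omega), sub_zero]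
      rintro (_ | l) hl
      · exact hγ (by rw [← hl]; field_simp; simp)
      · refine h l ?_
        rw [← hl, pow_succ (N : ℚ) (l + 1)]
        field_simp

end HahnSeries

/-! ### Polynomials whose roots are translates by a finite group -/

section Translation

theorem eq_prod_X_sub_C {K ι : Type*} [Field K] {f : K[X]} (hf : f.Monic) {s : Finset ι} {a : ι → K}
    (ha : Set.InjOn a s) (hs : ∀ i ∈ s, f.IsRoot (a i)) (hcard : f.natDegree ≤ s.card) :
    f = ∏ i ∈ s, (X - C (a i)) := by
  have h1 : (s.val.map a) ≤ f.roots := by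
    rw [Multiset.le_iff_subset]
    · intro x hx
      obtain ⟨i, hi, rfl⟩ := Multiset.mem_map.1 hx
      exact (mem_roots hf.ne_zero).2 (hs i hi)
    · exact Multiset.Nodup.map_on (fun x hx y hy h => ha hx hy h) s.nodup
  have h2 := (Multiset.prod_X_sub_C_dvd_iff_le_roots hf.ne_zero _).2 h1
  rw [Multiset.map_map] at h2
  refine (eq_of_monic_of_dvd_of_natDegree_le (monic_prod_X_sub_C a s) hf h2 ?_)
  rwa [natDegree_finsetProd_X_sub_C_eq_card]

/-- If the roots of `P` over `K` are the translates of `y` by a finite additive subgroup `V` of `k`,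
the roots of the minimal polynomial of `y` are the translates by a subgroup `W` of `V`. -/
theorem exists_stabilizer {k K L : Type*} [Field k] [Field K] [Field L] [Algebra k K] [Algebra k L]
    [Algebra K L] [IsScalarTower k K L] {V : Finset k} (hV0 : 0 ∈ V)
    (hV : ∀ a ∈ V, ∀ b ∈ V, a + b ∈ V) {y : L} {P : K[X]} (hP0 : P ≠ 0)
    (hP : P.map (algebraMap K L) = ∏ β ∈ V, (X - C (y - algebraMap k L β))) :
    ∃ W ⊆ V, 0 ∈ W ∧ (∀ a ∈ W, ∀ b ∈ W, a + b ∈ W) ∧ W.card = (minpoly K y).natDegree ∧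
      aeval y (∏ β ∈ W, (X - C β)) ∈ (algebraMap K L).range := by
  classical
  have hinj : Function.Injective fun β : k => y - algebraMap k L β := fun a b h =>
    (algebraMap k L).injective (sub_right_injective h)
  have hPy : aeval y P = 0 := by
    rw [← eval_map_algebraMap, hP, eval_prod]
    exact Finset.prod_eq_zero hV0 (by simp)
  have hint : IsIntegral K y := isAlgebraic_iff_isIntegral.1 ⟨P, hP0, hPy⟩
  set m := minpoly K y with hm
  have hmm : m.Monic := minpoly.monic hint
  -- W turns out to be the stabilizer of m in V: for β in W, m(X - β) is monic, vanishes at y and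
  -- has the degree of m, so it equals m.
  set W := V.filter (fun β => aeval (y - algebraMap k L β) m = 0) with hW
  have h0W : 0 ∈ W := by
    rw [hW, Finset.mem_filter]
    exact ⟨hV0, by rw [map_zero, sub_zero, minpoly.aeval]⟩
  have htr : ∀ β ∈ W, m.comp (X - C (algebraMap k K β)) = m := by
    intro β hβ
    have h1 : aeval y (m.comp (X - C (algebraMap k K β))) = 0 := by
      rw [aeval_comp]
      simpa [← IsScalarTower.algebraMap_apply] using (Finset.mem_filter.1 hβ).2
    refine (eq_of_monic_of_dvd_of_natDegree_le hmm (hmm.comp_X_sub_C _) (minpoly.dvd K y h1) ?_)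
    rw [natDegree_comp, natDegree_X_sub_C, mul_one]
  have hWadd : ∀ a ∈ W, ∀ b ∈ W, a + b ∈ W := by
    intro a ha b hb
    obtain ⟨haV, ha'⟩ := Finset.mem_filter.1 ha
    refine Finset.mem_filter.2 ⟨hV a haV b (Finset.mem_filter.1 hb).1, ?_⟩
    rw [← htr b hb, aeval_comp] at ha'
    simpa [← IsScalarTower.algebraMap_apply, sub_sub] using ha'
  have hdvd : m.map (algebraMap K L) ∣ ∏ β ∈ V, (X - C (y - algebraMap k L β)) := by
    rw [← hP]
    exact Polynomial.map_dvd _ (minpoly.dvd K y hPy)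
  have hprod0 : ∏ β ∈ V, (X - C (y - algebraMap k L β)) ≠ 0 :=
    (monic_prod_X_sub_C _ V).ne_zero
  have hsplit : (m.map (algebraMap K L)).Splits :=
    Splits.of_dvd (Splits.prod fun i _ => Splits.X_sub_C _) hprod0 hdvd
  have hroots : (∏ β ∈ V, (X - C (y - algebraMap k L β))).roots
      = V.val.map fun β => y - algebraMap k L β := by
    have := roots_multiset_prod_X_sub_C (V.val.map fun β => y - algebraMap k L β)
    rw [Multiset.map_map] at this
    exact this
  have hle := roots.le_of_dvd hprod0 hdvd
  rw [hroots] at hle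
  have hnodup : (m.map (algebraMap K L)).roots.Nodup :=
    Multiset.nodup_of_le hle (V.nodup.map hinj)
  have hcard : m.natDegree ≤ W.card := by
    rw [← natDegree_map (algebraMap K L), hsplit.natDegree_eq_card_roots,
      ← Multiset.toFinset_card_of_nodup hnodup, ← Finset.card_image_of_injective W hinj]
    refine Finset.card_le_card fun x hx => ?_
    rw [Multiset.mem_toFinset] at hx
    obtain ⟨β, hβ, rfl⟩ := Multiset.mem_map.1 (Multiset.mem_of_le hle hx)
    refine Finset.mem_image.2 ⟨β, Finset.mem_filter.2 ⟨hβ, ?_⟩, rfl⟩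
    rw [← eval_map_algebraMap]
    exact (mem_roots'.1 hx).2
  have hmprod : m.map (algebraMap K L) = ∏ β ∈ W, (X - C (y - algebraMap k L β)) := by
    refine eq_prod_X_sub_C (hmm.map _) hinj.injOn (fun β hβ => ?_) (by rwa [natDegree_map])
    rw [IsRoot, eval_map_algebraMap]
    exact (Finset.mem_filter.1 hβ).2
  -- The product of the y - β over W is, up to sign, the constant term of the minimal polynomial.
  refine ⟨W, Finset.filter_subset _ _, h0W, hWadd, ?_, (-1) ^ W.card * m.eval 0, ?_⟩
  · have := congrArg natDegree hmprod
    rw [natDegree_map, natDegree_finsetProd_X_sub_C_eq_card] at this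
    exact this.symm
  · have h1 : algebraMap K L (m.eval 0) = (m.map (algebraMap K L)).eval 0 := by
      rw [eval_map_algebraMap, ← map_zero (algebraMap K L), aeval_algebraMap_apply]
      simp
    rw [map_mul, h1, hmprod, eval_prod, map_prod, map_pow, map_neg, map_one, ← Finset.prod_const,
      ← Finset.prod_mul_distrib]
    exact Finset.prod_congr rfl fun β _ => by simp

/-- The polynomial F(X + b) - F(X) - F(b) has degree less than |W|, since leading terms cancel, and
vanishes on W by translation invariance; so it is zero. -/
theorem aeval_add_prod_X_sub_C {k L : Type*} [Field k] [Field L] [Algebra k L] {W : Finset k}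
    (h0 : 0 ∈ W) (hW : ∀ a ∈ W, ∀ b ∈ W, a + b ∈ W) (a b : L) :
    aeval (a + b) (∏ β ∈ W, (X - C β)) =
      aeval a (∏ β ∈ W, (X - C β)) + aeval b (∏ β ∈ W, (X - C β)) := by
  classical
  set M := ∏ β ∈ W, (X - C β) with hM
  have hMm : M.Monic := monic_prod_X_sub_C _ W
  set F := M.map (algebraMap k L) with hF
  have hFm : F.Monic := hMm.map _
  have hdeg : F.natDegree = W.card := by
    rw [hF, natDegree_map, hM, natDegree_finsetProd_X_sub_C_eq_card]
  have htr : ∀ w ∈ W, F.eval (algebraMap k L w + b) = F.eval b := by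
    intro w hw
    have him : W.map (addLeftEmbedding w) = W := by
      refine Finset.eq_of_subset_of_card_le (fun x hx => ?_) (by rw [Finset.card_map])
      obtain ⟨v, hv, rfl⟩ := Finset.mem_map.1 hx
      exact hW w hw v hv
    simp only [hF, hM, eval_map_algebraMap, map_prod]
    conv_lhs => rw [← him, Finset.prod_map]
    refine Finset.prod_congr rfl fun v _ => ?_
    simp
  have hw0 : ∀ w ∈ W, F.eval (algebraMap k L w) = 0 := by
    intro w hw
    rw [hF, eval_map_algebraMap, hM, map_prod]
    exact Finset.prod_eq_zero hw (by simp)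
  have key : F.comp (X + C b) - F - C (F.eval b) = 0 := by
    refine eq_zero_of_degree_lt_of_eval_finset_eq_zero (W.map ⟨algebraMap k L,
      (algebraMap k L).injective⟩) ?_ ?_
    · rw [Finset.card_map, ← hdeg, ← degree_eq_natDegree hFm.ne_zero]
      have hd : (F.comp (X + C b)).degree = F.degree := by
        rw [degree_eq_natDegree (hFm.comp_X_add_C b).ne_zero, degree_eq_natDegree hFm.ne_zero,
          natDegree_comp, natDegree_X_add_C, mul_one]
      refine (degree_sub_le _ _).trans_lt (max_lt ?_ ?_)
      · rw [← hd]
        refine degree_sub_lt_left hd (hFm.comp_X_add_C b).ne_zero ?_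
        rw [(hFm.comp_X_add_C b).leadingCoeff, hFm.leadingCoeff]
      · refine degree_C_le.trans_lt ?_
        rw [← natDegree_pos_iff_degree_pos, hdeg]
        exact Finset.card_pos.2 ⟨0, h0⟩
    · intro x hx
      obtain ⟨w, hw, rfl⟩ := Finset.mem_map.1 hx
      simp only [Function.Embedding.coeFn_mk, eval_sub, eval_comp, eval_add, eval_X, eval_C]
      rw [htr w hw, hw0 w hw]
      ring
  have := congrArg (eval a) key
  simp only [eval_sub, eval_comp, eval_add, eval_X, eval_C, eval_zero, hF,
    eval_map_algebraMap] at this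
  linear_combination this

end Translation

/-! ### Laurent series inside Hahn series -/

section IntegerSupport

variable (k : Type*) [Field k]

/-- The field of Laurent series inside the Hahn series with rational exponents. -/
noncomputable def intSupport : IntermediateField k (HahnSeries ℚ k) :=
  (HahnSeries.embDomainAlgHom (R := k) (A := k) (Int.castAddHom ℚ) Int.cast_injective
    (fun _ _ => Int.cast_le)).fieldRange

variable {k}

theorem coeff_eq_zero_of_mem_intSupport {f : HahnSeries ℚ k} (hf : f ∈ intSupport k) {γ : ℚ}
    (hγ : ∀ j : ℤ, γ ≠ j) : f.coeff γ = 0 := by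
  obtain ⟨g, rfl⟩ := hf
  exact HahnSeries.embDomain_of_notMem_range (fun ⟨j, hj⟩ => hγ j hj.symm)

theorem single_mem_intSupport (j : ℤ) (c : k) : HahnSeries.single (j : ℚ) c ∈ intSupport k :=
  ⟨HahnSeries.single j c, HahnSeries.embDomain_single⟩

end IntegerSupport

theorem eq_of_pow_mul_eq_pow_mul {p a b u v : ℕ} (hp : p.Prime) (hu : ¬ p ∣ u) (hv : ¬ p ∣ v)
    (h : p ^ a * u = p ^ b * v) : u = v := by
  wlog hab : a ≤ b generalizing a b u v
  · exact (this hv hu h.symm (le_of_not_ge hab)).symm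
  obtain ⟨c, rfl⟩ := Nat.exists_eq_add_of_le hab
  rw [pow_add, mul_assoc] at h
  have h' := Nat.eq_of_mul_eq_mul_left (pow_pos hp.pos a) h
  rcases c with _ | c
  · simpa using h'
  · refine absurd ?_ hu
    rw [h', pow_succ', mul_assoc]
    exact dvd_mul_right _ _

/-! ### The series S and its Frobenius powers -/

section Series

variable (k : Type*) [Field k] {p e q n r : ℕ} [Fact p.Prime] [CharP k p]

/-- The solution of `S ^ (q ^ n) - S = x ^ (q ^ n + q ^ (n - r)) - x ^ (q ^ (n - r) + 1)`, where
`x = t⁻¹`. -/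
noncomputable def curveSeries (q n r : ℕ) (hN : 1 < q ^ n) : HahnSeries ℚ k :=
  geomSeries k (q ^ n) hN (q ^ n + q ^ (n - r) : ℕ) (by positivity) -
    geomSeries k (q ^ n) hN (q ^ (n - r) + 1 : ℕ) (by positivity)

variable {k}

theorem curveSeries_pow_sub (hq : q = p ^ e) (hN : 1 < q ^ n) :
    curveSeries k q n r hN ^ q ^ n - curveSeries k q n r hN =
      HahnSeries.single (-1) 1 ^ (q ^ n + q ^ (n - r))
        - HahnSeries.single (-1) 1 ^ (q ^ (n - r) + 1) := by
  have := charP_hahnSeries k p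
  have hN' : q ^ n = p ^ (e * n) := by rw [hq, ← pow_mul]
  have h3 : ∀ a b : HahnSeries ℚ k, (a - b) ^ q ^ n = a ^ q ^ n - b ^ q ^ n := fun a b => by
    rw [hN', sub_pow_char_pow]
  rw [curveSeries, h3, sub_sub_sub_comm, geomSeries_pow_sub hN', geomSeries_pow_sub hN',
    HahnSeries.single_pow, HahnSeries.single_pow]
  simp

/-- The exponent is the first one of the second geometric series. It can recur there in S^(p^j) only
if p^j is a power of q^n, so only for j = 0. In the first series it would force the prime-to-p parts
q^r + 1 and q^(n-r) + 1 to agree, that is n = 2r. -/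
theorem coeff_curveSeries_pow (hq : q = p ^ e) (hq1 : 1 < q) (hN : 1 < q ^ n) (hrn : r < n)
    (hr0 : 0 < r) (hnr : n - r ≠ r) {j : ℕ} (hj : p ^ j < q ^ n) :
    (curveSeries k q n r hN ^ p ^ j).coeff (-(q ^ (n - r) + 1 : ℕ) / (q ^ n : ℕ)) =
      if j = 0 then -1 else 0 := by
  have hp : p.Prime := Fact.out
  have hq0 : 0 < q := by omega
  have he : e ≠ 0 := by rintro rfl; simp at hq; omega
  have hpq : p ∣ q := hq ▸ dvd_pow_self p he
  have hnd : ∀ m, m ≠ 0 → ¬ p ∣ q ^ m + 1 := fun m hm h =>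
    hp.one_lt.ne' (Nat.dvd_one.1 ((Nat.dvd_add_right (dvd_pow hpq hm)).1 h))
  have hN0 : ((q ^ n : ℕ) : ℚ) ≠ 0 := by positivity
  have hpj : ((p : ℚ) ^ j) ≠ 0 := pow_ne_zero _ (by exact_mod_cast hp.ne_zero)
  rw [coeff_hahnSeries_pow_char_pow, curveSeries, HahnSeries.coeff_sub,
    coeff_geomSeries_of_ne, zero_sub]
  · split_ifs with h0
    · subst h0
      rw [coeff_geomSeries_of_eq 0]
      · simp
      · simp only [pow_zero, div_one, zero_add, pow_one]
        rw [div_mul_cancel₀ _ hN0]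
    · rw [coeff_geomSeries_of_ne, neg_zero, zero_pow (pow_ne_zero _ hp.ne_zero)]
      intro l hl
      rw [pow_succ, div_div, neg_div, neg_mul, neg_inj, div_mul_eq_mul_div,
        div_eq_iff (mul_ne_zero hN0 hpj)] at hl
      have hl' : (q ^ n) ^ l = p ^ j := by
        have h1 : ((q ^ (n - r) + 1 : ℕ) : ℚ) * (q ^ n : ℕ) ≠ 0 := by positivity
        have : ((q ^ n : ℕ) : ℚ) ^ l = (p : ℚ) ^ j :=
          mul_left_cancel₀ h1 (by linear_combination hl)
        exact_mod_cast this
      rcases l with _ | l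
      · rw [pow_zero, eq_comm, Nat.pow_eq_one] at hl'
        exact hl'.elim hp.one_lt.ne' h0
      · have : q ^ n ≤ (q ^ n) ^ (l + 1) := Nat.le_self_pow (Nat.succ_ne_zero l) _
        omega
  · intro l hl
    rw [pow_succ, div_div, neg_div, neg_mul, neg_inj, div_mul_eq_mul_div,
      div_eq_iff (mul_ne_zero hN0 hpj)] at hl
    have hl' : (q ^ n) ^ l * (q ^ (n - r) + 1) = (q ^ n + q ^ (n - r)) * p ^ j := by
      have : ((q ^ n : ℕ) : ℚ) ^ l * ((q ^ (n - r) + 1 : ℕ) : ℚ) =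
          ((q ^ n + q ^ (n - r) : ℕ) : ℚ) * (p : ℚ) ^ j :=
        mul_left_cancel₀ hN0 (by linear_combination hl)
      exact_mod_cast this
    have hsum : q ^ n + q ^ (n - r) = q ^ (n - r) * (q ^ r + 1) := by
      rw [mul_add, mul_one, ← pow_add, Nat.sub_add_cancel hrn.le]
    have h2 : p ^ (e * n * l) * (q ^ (n - r) + 1) = p ^ (e * (n - r) + j) * (q ^ r + 1) := by
      rw [pow_mul, pow_mul, ← hq, hl', hsum, pow_add, pow_mul, ← hq]
      ring
    have h3 := eq_of_pow_mul_eq_pow_mul hp (hnd _ (by omega)) (hnd _ hr0.ne') h2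
    exact hnr (Nat.pow_right_injective hq1 (Nat.succ_injective h3))

end Series

/-- Lets polynomial identities, such as additivity, be tested on values in Hahn series. -/
instance {k : Type*} [Field k] : Infinite (HahnSeries ℚ k) :=
  Infinite.of_injective (fun i : ℕ => HahnSeries.single (i : ℚ) (1 : k)) fun i j h => by
    have h1 := congrArg HahnSeries.order h
    simp only [HahnSeries.order_single (one_ne_zero (α := k))] at h1
    exact_mod_cast h1

/-! ### The degree of Y over the Laurent series -/

section MinPoly

variable {k : Type*} [Field k] {p e q n r s : ℕ} [Fact p.Prime] [CharP k p]

theorem IsQPoly.derivative_eq (hq : q = p ^ e) (hq1 : 1 < q) {f : k[X]} (hf : IsQPoly q f) :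
    derivative f = C (f.coeff 1) := by
  have hqk : (q : k) = 0 := by
    have he : e ≠ 0 := by rintro rfl; simp at hq; omega
    rw [hq]
    simp [he]
  ext i
  rw [coeff_derivative, coeff_C]
  split_ifs with h
  · simp [h]
  · by_cases h0 : f.coeff (i + 1) = 0
    · rw [h0, zero_mul]
    · obtain ⟨j, hj⟩ := hf _ h0
      have hj0 : j ≠ 0 := by rintro rfl; simp at hj; exact h hj
      have : ((i : k) + 1) = ((i + 1 : ℕ) : k) := by push_cast; ring
      rw [this, hj]
      simp [hqk, hj0]

theorem neg_div_ne_intCast (hq1 : 1 < q) (hrn : r < n) (hr0 : 0 < r) (j : ℤ) :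
    (-(q ^ (n - r) + 1 : ℕ) / (q ^ n : ℕ) : ℚ) ≠ j := by
  intro h
  have hq0 : 0 < q := by omega
  have hN0 : (0 : ℚ) < (q ^ n : ℕ) := by positivity
  rw [div_eq_iff hN0.ne'] at h
  have h1 : -((q ^ (n - r) + 1 : ℕ) : ℤ) = j * (q ^ n : ℕ) := by exact_mod_cast h
  have h2 : q ^ n ∣ q ^ (n - r) + 1 := by
    have : ((q ^ n : ℕ) : ℤ) ∣ ((q ^ (n - r) + 1 : ℕ) : ℤ) :=
      (dvd_neg).1 (h1 ▸ dvd_mul_left _ _)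
    exact_mod_cast this
  have h3 : q ∣ q ^ (n - r) := dvd_pow_self q (by omega)
  have h4 : q ∣ q ^ (n - r) + 1 := (dvd_pow_self q (by omega)).trans h2
  have h5 := Nat.dvd_one.1 ((Nat.dvd_add_right h3).1 h4)
  omega

theorem aeval_curveSeries_comp (hq : q = p ^ e) (hN : 1 < q ^ n) {gs h : k[X]}
    (hcomp : gs.comp h = X ^ q ^ n - X) : aeval (aeval (curveSeries k q n r hN) h) gs =
      HahnSeries.single (-1) 1 ^ (q ^ n + q ^ (n - r))
        - HahnSeries.single (-1) 1 ^ (q ^ (n - r) + 1) := by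
  rw [← aeval_comp, hcomp]
  simp [curveSeries_pow_sub hq]

/-- The irreducibility statement. A smaller degree yields an additive D of degree less than q^n,
with nonzero linear term, such that D(S) is a Laurent series; but D(S) has a nonzero coefficient at
a non-integral exponent. -/
theorem natDegree_minpoly (hq : q = p ^ e) (hq1 : 1 < q) (hN : 1 < q ^ n) (hrn : r < n)
    (hr0 : 0 < r) (hnr : n - r ≠ r) {gs h : k[X]} (hgs : IsQPoly q gs) (hgm : gs.Monic)
    (hsp : gs.Splits) (hh : IsQPoly q h) (hcomp : gs.comp h = X ^ q ^ n - X) :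
    (minpoly (intSupport k) (aeval (curveSeries k q n r hN) h)).natDegree = gs.natDegree := by
  classical
  have := charP_hahnSeries k p
  have hq0 : 0 < q := by omega
  set S := curveSeries k q n r hN with hS
  set Y := aeval S h with hY
  -- Comparing linear terms in gs∘h = X^(q^n) - X shows that gs is separable and that h has a
  -- nonzero linear coefficient.
  have h11 : gs.coeff 1 * h.coeff 1 = -1 := by
    rw [← coeff_one_comp (hh.coeff_zero hq0), hcomp, coeff_sub, coeff_X_pow, coeff_X_one,
      if_neg hN.ne, zero_sub]
  have hgs1 : gs.coeff 1 ≠ 0 := fun h0 => by simp [h0] at h11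
  have hh1 : h.coeff 1 ≠ 0 := fun h0 => by simp [h0] at h11
  have hsep : gs.Separable := by
    rw [separable_def, hgs.derivative_eq hq hq1]
    exact isCoprime_one_right.of_isCoprime_of_dvd_right (isUnit_C.2 hgs1.isUnit).dvd
  set V := gs.roots.toFinset with hV
  have hVcard : V.card = gs.natDegree := by
    rw [hV, Multiset.toFinset_card_of_nodup (nodup_roots hsep), ← hsp.natDegree_eq_card_roots]
  have hmemV : ∀ a, a ∈ V ↔ gs.eval a = 0 := fun a => by
    rw [hV, Multiset.mem_toFinset, mem_roots hgm.ne_zero, IsRoot]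
  have hF : HahnSeries.single (-1) 1 ^ (q ^ n + q ^ (n - r))
        - HahnSeries.single (-1) 1 ^ (q ^ (n - r) + 1) ∈ intSupport k := by
    have := single_mem_intSupport (k := k) (-1) 1
    push_cast at this
    exact sub_mem (pow_mem this _) (pow_mem this _)
  set F : intSupport k := ⟨_, hF⟩ with hFdef
  have hgY : aeval Y gs = algebraMap (intSupport k) (HahnSeries ℚ k) F :=
    aeval_curveSeries_comp hq hN hcomp
  set P : (intSupport k)[X] := gs.map (algebraMap k (intSupport k)) - C F with hP
  have hgpos : 0 < gs.natDegree := by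
    have := congrArg natDegree hcomp
    rw [natDegree_comp, natDegree_sub_eq_left_of_natDegree_lt (by simpa using hN),
      natDegree_X_pow] at this
    exact Nat.pos_of_ne_zero fun h0 => by rw [h0, zero_mul] at this; omega
  have hPm : P.Monic := by
    refine (hgm.map _).sub_of_left ?_
    refine degree_C_le.trans_lt ?_
    rw [← natDegree_pos_iff_degree_pos, natDegree_map]
    exact hgpos
  have hPdeg : P.natDegree = gs.natDegree := by rw [hP, natDegree_sub_C, natDegree_map]
  have hPprod : P.map (algebraMap (intSupport k) (HahnSeries ℚ k)) =
      ∏ β ∈ V, (X - C (Y - algebraMap k (HahnSeries ℚ k) β)) := by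
    refine eq_prod_X_sub_C (hPm.map _) ?_ (fun β hβ => ?_) ?_
    · exact fun a _ b _ h => (algebraMap k (HahnSeries ℚ k)).injective (sub_right_injective h)
    · rw [IsRoot, hP, Polynomial.map_sub, map_map, ← IsScalarTower.algebraMap_eq, map_C, eval_sub,
        eval_C, eval_map_algebraMap, hgs.aeval_sub hq, hgY, aeval_algebraMap_apply,
        coe_aeval_eq_eval, (hmemV β).1 hβ]
      simp
    · rw [natDegree_map, hPdeg, hVcard]
  have hadd : ∀ a b : k, gs.eval (a + b) = gs.eval a + gs.eval b := fun a b => by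
    simpa using hgs.aeval_add hq a b
  have hV0 : 0 ∈ V := by rw [hmemV, ← coeff_zero_eq_eval_zero, hgs.coeff_zero hq0]
  obtain ⟨W, hWV, hW0, hW, hWcard, hz⟩ := exists_stabilizer hV0
    (fun a ha b hb => by rw [hmemV] at *; rw [hadd, ha, hb, add_zero]) hPm.ne_zero hPprod
  rw [← hWcard, ← hVcard]
  by_contra hne
  have hlt : W.card < V.card := lt_of_le_of_ne (Finset.card_le_card hWV) hne
  set M := ∏ β ∈ W, (X - C β) with hM
  have hM0 : M.coeff 0 = 0 := by
    rw [coeff_zero_eq_eval_zero, hM, eval_prod]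
    exact Finset.prod_eq_zero hW0 (by simp)
  have hM1 : M.coeff 1 ≠ 0 := by
    obtain ⟨B, hB⟩ : M ∣ gs := by
      rw [eq_prod_X_sub_C hgm (s := V) (a := id) Function.injective_id.injOn
        (fun β hβ => (hmemV β).1 hβ) hVcard.ge]
      exact Finset.prod_dvd_prod_of_subset _ _ _ hWV
    intro h0
    have := congrArg (fun f => coeff f 1) hB
    simp only [coeff_mul, Finset.Nat.antidiagonal_succ, Finset.Nat.antidiagonal_zero] at this
    simp [hM0, h0] at this
    exact hgs1 this
  set D := M.comp h with hD
  have hDadd : ∀ a b : HahnSeries ℚ k, aeval (a + b) D = aeval a D + aeval b D := fun a b => by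
    simp only [hD, aeval_comp]
    rw [hh.aeval_add hq, hM, aeval_add_prod_X_sub_C hW0 hW]
  have hDdeg : D.natDegree < q ^ n := by
    have h1 := congrArg natDegree hcomp
    rw [natDegree_comp, natDegree_sub_eq_left_of_natDegree_lt (by simpa using hN),
      natDegree_X_pow] at h1
    rw [hD, natDegree_comp, hM, natDegree_finsetProd_X_sub_C_eq_card, ← h1, ← hVcard]
    refine Nat.mul_lt_mul_of_pos_right hlt (Nat.pos_of_ne_zero fun h0 => ?_)
    rw [h0, mul_zero] at h1
    omega
  have hD1 : D.coeff 1 ≠ 0 := by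
    rw [hD, coeff_one_comp (hh.coeff_zero hq0)]
    exact mul_ne_zero hM1 hh1
  -- D is only known to be additive, so its exponents are powers of p, not of q. Those that occur
  -- are less than q^n, and only p^0 contributes to this coefficient.
  have hcoeff : (aeval S D).coeff (-(q ^ (n - r) + 1 : ℕ) / (q ^ n : ℕ)) = -D.coeff 1 := by
    rw [aeval_eq_sum_range, HahnSeries.coeff_sum, Finset.sum_eq_single 1]
    · have := coeff_curveSeries_pow (k := k) hq hq1 hN hrn hr0 hnr (j := 0) (by simpa using hN)
      rw [pow_zero, if_pos rfl] at this
      rw [HahnSeries.coeff_smul, hS, this, smul_eq_mul, mul_neg_one]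
    · intro i hi hi1
      by_cases h0 : D.coeff i = 0
      · simp [h0]
      · obtain ⟨j, rfl⟩ := exists_pow_of_additive hDadd h0
        have hj0 : j ≠ 0 := by rintro rfl; simp at hi1
        rw [HahnSeries.coeff_smul, hS, coeff_curveSeries_pow hq hq1 hN hrn hr0 hnr
          ((le_natDegree_of_ne_zero h0).trans_lt hDdeg), if_neg hj0, smul_zero]
    · intro h1
      have : D.natDegree < 1 := by simpa using h1
      simp [coeff_eq_zero_of_natDegree_lt this]
  have hmem : aeval S D ∈ intSupport k := by
    obtain ⟨z, hz⟩ := hz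
    rw [hD, aeval_comp, ← hY, ← hz]
    exact z.2
  rw [coeff_eq_zero_of_mem_intSupport hmem (neg_div_ne_intCast hq1 hrn hr0)] at hcoeff
  exact hD1 (neg_eq_zero.1 hcoeff.symm)

end MinPoly

/-! ### Total ramification of finite extensions inside Hahn series -/

section Ramification

open HahnSeries

variable {k : Type*} [Field k]

/-- With distinct orders, nothing cancels at the least one. -/
theorem orderTop_sum_le {ι : Type*} {s : Finset ι} {f : ι → HahnSeries ℚ k}
    (hf : ∀ i ∈ s, ∀ j ∈ s, f i ≠ 0 → f j ≠ 0 → (f i).order = (f j).order → i = j) {j : ι}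
    (hj : j ∈ s) : (∑ i ∈ s, f i).orderTop ≤ (f j).orderTop := by
  classical
  by_cases h0 : f j = 0
  · simp [h0]
  obtain ⟨i, hi, hmin⟩ := Finset.exists_min_image (s.filter fun i => f i ≠ 0)
    (fun i => (f i).order) ⟨j, Finset.mem_filter.2 ⟨hj, h0⟩⟩
  obtain ⟨his, hi0⟩ := Finset.mem_filter.1 hi
  have hle := hmin j (Finset.mem_filter.2 ⟨hj, h0⟩)
  have hc : (∑ l ∈ s, f l).coeff (f i).order = (f i).coeff (f i).order := by
    rw [HahnSeries.coeff_sum]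
    refine Finset.sum_eq_single_of_mem i his fun l hl hli => ?_
    by_cases hl0 : f l = 0
    · simp [hl0]
    · refine coeff_eq_zero_of_lt_order
        (lt_of_le_of_ne (hmin l (Finset.mem_filter.2 ⟨hl, hl0⟩)) fun h => ?_)
      exact hli (hf l hl i his hl0 hi0 h.symm)
  rw [← order_eq_orderTop_of_ne_zero h0]
  refine (orderTop_le_of_coeff_ne_zero (g := (f i).order) ?_).trans (by exact_mod_cast hle)
  rw [hc]
  exact fun h => hi0 (coeff_order_eq_zero.1 h)

theorem exists_order_eq_intCast {f : HahnSeries ℚ k} (hf : f ∈ intSupport k) :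
    ∃ j : ℤ, f.order = j := by
  by_cases h0 : f = 0
  · exact ⟨0, by simp [h0]⟩
  · by_contra! h
    exact h0 (coeff_order_eq_zero.1 (coeff_eq_zero_of_mem_intSupport hf h))

variable {ι : Type*} {π : ι → HahnSeries ℚ k} (hπ0 : ∀ i, π i ≠ 0)
  (hπ : ∀ i i', ∀ j : ℤ, (π i).order = (π i').order + j → i = i')

include hπ0 hπ in
theorem orderTop_sum_smul_le {s : Finset ι} (c : ι → intSupport k) {i : ι} (hi : i ∈ s) :
    (∑ i ∈ s, c i • π i).orderTop ≤ (c i • π i).orderTop := by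
  refine orderTop_sum_le (f := fun i => c i • π i) (fun i _ i' _ h h' heq => ?_) hi
  simp only [IntermediateField.smul_def, smul_eq_mul] at h h' heq
  have h1 := left_ne_zero_of_mul h
  have h1' := left_ne_zero_of_mul h'
  rw [order_mul h1 (hπ0 i), order_mul h1' (hπ0 i')] at heq
  obtain ⟨j, hj⟩ := exists_order_eq_intCast (c i).2
  obtain ⟨j', hj'⟩ := exists_order_eq_intCast (c i').2
  refine hπ i i' (j' - j) ?_
  push_cast
  linarith

include hπ0 hπ in
theorem linearIndependent_of_order : LinearIndependent (intSupport k) π := by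
  rw [linearIndependent_iff']
  intro s c hc i hi
  have := orderTop_sum_smul_le hπ0 hπ c hi
  rw [hc, orderTop_zero, top_le_iff, orderTop_eq_top, IntermediateField.smul_def, smul_eq_mul,
    mul_eq_zero] at this
  exact Subtype.ext (this.resolve_right (hπ0 i))

include hπ0 hπ in
/-- The span over the Laurent series of elements with distinct orders modulo `ℤ` is closed. -/
theorem exists_eq_sum_of_approx [Fintype ι] {a : HahnSeries ℚ k}
    (ha : ∀ N : ℕ, ∃ c : ι → intSupport k,
      (((N : ℚ) : WithTop ℚ)) ≤ (a - ∑ i, c i • π i).orderTop) :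
    ∃ c : ι → intSupport k, a = ∑ i, c i • π i := by
  choose c hc using ha
  obtain ⟨B, hB⟩ : ∃ B : ℕ, ∀ i, |(π i).order| ≤ B := by
    obtain ⟨B, hB⟩ := exists_nat_ge (∑ i, |(π i).order|)
    exact ⟨B, fun i => (Finset.single_le_sum (f := fun i => |(π i).order|)
      (fun _ _ => abs_nonneg _) (Finset.mem_univ i)).trans hB⟩
  -- The coordinates form Cauchy sequences: no cancellation is possible among the terms (c_N - c_M)
  -- π_i, so each has order at least M, and dividing by π_i loses at most B.
  have hcoeff : ∀ M N : ℕ, M ≤ N → ∀ i, ∀ γ : ℚ, γ + B < M →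
      (c N i : HahnSeries ℚ k).coeff γ = (c M i : HahnSeries ℚ k).coeff γ := by
    intro M N hMN i γ hγ
    have h1 : ((M : ℚ) : WithTop ℚ) ≤ (∑ i, (c N i - c M i) • π i).orderTop := by
      have h2 : ∑ i, (c N i - c M i) • π i =
          (a - ∑ i, c M i • π i) - (a - ∑ i, c N i • π i) := by
        simp only [sub_smul, Finset.sum_sub_distrib]
        ring
      rw [h2]
      refine le_trans (le_min (hc M) (le_trans ?_ (hc N))) min_orderTop_le_orderTop_sub
      exact_mod_cast hMN
    have h3 := h1.trans (orderTop_sum_smul_le hπ0 hπ _ (Finset.mem_univ i))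
    rw [IntermediateField.smul_def, smul_eq_mul, orderTop_mul,
      ← order_eq_orderTop_of_ne_zero (hπ0 i)] at h3
    have h4 : (γ : WithTop ℚ) < ((c N i - c M i : intSupport k) : HahnSeries ℚ k).orderTop := by
      by_contra h
      rw [not_lt] at h
      have h5 := h3.trans (add_le_add_left h _)
      rw [← WithTop.coe_add, WithTop.coe_le_coe] at h5
      linarith [le_of_abs_le (hB i)]
    have h6 := coeff_eq_zero_of_lt_orderTop h4
    rw [AddSubgroupClass.coe_sub, HahnSeries.coeff_sub] at h6
    exact sub_eq_zero.1 h6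
  have hd : ∀ i, ∃ d : intSupport k, ∀ M : ℕ, ∀ γ : ℚ, γ + B < M →
      (d : HahnSeries ℚ k).coeff γ = (c M i : HahnSeries ℚ k).coeff γ := by
    intro i
    -- The limit is built coefficientwise; from index `N j` on, the coefficient at j is stable.
    set N : ℤ → ℕ := fun j => (j + B + 1).toNat with hN
    obtain ⟨j₀, hj₀⟩ := exists_order_eq_intCast (c 0 i).2
    have hNj : ∀ j : ℤ, (j : ℚ) + B < N j := fun j => by
      have : j + B + 1 ≤ ((j + B + 1).toNat : ℤ) := Int.self_le_toNat _
      have h2 : ((j + B + 1 : ℤ) : ℚ) ≤ ((N j : ℤ) : ℚ) := by exact_mod_cast this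
      push_cast at h2
      linarith
    set g : HahnSeries ℤ k := ofSuppBddBelow
      (fun j : ℤ => (c (N j) i : HahnSeries ℚ k).coeff j) ⟨min j₀ (-B), by
        intro j hj
        by_contra h
        rw [not_le, lt_min_iff] at h
        refine hj ?_
        have h1 : (j : ℚ) + B < (0 : ℕ) := by
          have : (j : ℚ) < ((-B : ℤ) : ℚ) := by exact_mod_cast h.2
          push_cast at this ⊢
          linarith
        change (c (N j) i : HahnSeries ℚ k).coeff j = 0
        rw [hcoeff 0 (N j) (Nat.zero_le _) i j h1]
        refine coeff_eq_zero_of_lt_order ?_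
        rw [hj₀]
        exact_mod_cast h.1⟩ with hg
    refine ⟨⟨embDomainAlgHom (R := k) (A := k) (Int.castAddHom ℚ) Int.cast_injective
      (fun _ _ => Int.cast_le) g, g, rfl⟩, fun M γ hγ => ?_⟩
    by_cases h : ∃ j : ℤ, γ = j
    · obtain ⟨j, rfl⟩ := h
      refine (embDomain_coeff (a := j)).trans ?_
      change (c (N j) i : HahnSeries ℚ k).coeff j = _
      rcases le_total M (N j) with hle | hle
      · exact hcoeff M (N j) hle i j hγ
      · exact (hcoeff (N j) M hle i j (hNj j)).symm
    · push Not at h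
      rw [coeff_eq_zero_of_mem_intSupport (c M i).2 h]
      exact coeff_eq_zero_of_mem_intSupport (Subtype.prop _) h
  choose d hd using hd
  refine ⟨d, ?_⟩
  rw [← sub_eq_zero, ← orderTop_eq_top]
  refine WithTop.eq_top_iff_forall_ge.2 fun x => ?_
  obtain ⟨M, hM⟩ := exists_nat_ge (x + 2 * B)
  have h1 : a - ∑ i, d i • π i = (a - ∑ i, c M i • π i) - ∑ i, (d i - c M i) • π i := by
    simp only [sub_smul, Finset.sum_sub_distrib]
    ring
  rw [h1, le_orderTop_iff_forall]
  intro γ hγ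
  have hγx : γ < x := WithTop.coe_lt_coe.1 hγ
  have hBM : (0 : ℚ) ≤ B := Nat.cast_nonneg B
  rw [HahnSeries.coeff_sub, coeff_eq_zero_of_lt_orderTop, HahnSeries.coeff_sum,
    Finset.sum_eq_zero, sub_zero]
  · intro i _
    refine coeff_eq_zero_of_lt_orderTop ?_
    rw [IntermediateField.smul_def, smul_eq_mul, orderTop_mul,
      ← order_eq_orderTop_of_ne_zero (hπ0 i)]
    have h2 : ((M - B : ℚ) : WithTop ℚ) ≤
        ((d i - c M i : intSupport k) : HahnSeries ℚ k).orderTop := by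
      rw [le_orderTop_iff_forall]
      intro γ' hγ'
      have h3 : γ' < M - B := WithTop.coe_lt_coe.1 hγ'
      rw [AddSubgroupClass.coe_sub, HahnSeries.coeff_sub, hd i M γ' (by linarith), sub_self]
    refine lt_of_lt_of_le ?_ (add_le_add_left h2 _)
    rw [← WithTop.coe_add, WithTop.coe_lt_coe]
    linarith [neg_le_of_abs_le (hB i)]
  · refine lt_of_lt_of_le ?_ (hc M)
    rw [WithTop.coe_lt_coe]
    linarith

theorem orderTop_sub_single_mul {a b : HahnSeries ℚ k} (ha : a ≠ 0) (hb : b ≠ 0) {γ : ℚ}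
    (h : a.order = γ + b.order) :
    (a.order : WithTop ℚ) <
      (a - single γ (a.leadingCoeff / b.leadingCoeff) * b).orderTop := by
  set c := a.leadingCoeff / b.leadingCoeff with hc
  have hc0 : c ≠ 0 := div_ne_zero (leadingCoeff_ne_zero.2 ha) (leadingCoeff_ne_zero.2 hb)
  have hord : (single γ c * b).order = a.order := by
    rw [order_mul (single_ne_zero hc0) hb, order_single hc0, h]
  have h1 : (a.order : WithTop ℚ) ≤ (a - single γ c * b).orderTop := by
    refine le_trans (le_min ?_ ?_) min_orderTop_le_orderTop_sub
    · rw [order_eq_orderTop_of_ne_zero ha]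
    · rw [← order_eq_orderTop_of_ne_zero (mul_ne_zero (single_ne_zero hc0) hb), hord]
  refine lt_of_le_of_ne h1 fun heq => ?_
  have h2 := coeff_orderTop_ne heq.symm
  apply h2
  rw [HahnSeries.coeff_sub]
  conv_lhs => rw [← hord, ← leadingCoeff_eq, hord, ← leadingCoeff_eq]
  rw [HahnSeries.leadingCoeff_mul, leadingCoeff_of_single, hc,
    div_mul_cancel₀ _ (leadingCoeff_ne_zero.2 hb), sub_self]

include hπ0 hπ in
/-- Elements representing all the orders modulo `ℤ` span, as the residue field does not grow. -/
theorem exists_eq_sum_of_orders [Fintype ι] {L : IntermediateField (intSupport k) (HahnSeries ℚ k)}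
    (hπL : ∀ i, π i ∈ L)
    (hex : ∀ f ∈ L, f ≠ 0 → ∃ i, ∃ j : ℤ, f.order = j + (π i).order) {m : ℕ} (hm : 0 < m)
    (hord : ∀ f ∈ L, f ≠ 0 → ∃ j : ℤ, m * f.order = j) {a : HahnSeries ℚ k} (ha : a ∈ L) :
    ∃ c : ι → intSupport k, a = ∑ i, c i • π i := by
  have hm0 : (0 : ℚ) < m := by exact_mod_cast hm
  have hsum : ∀ c : ι → intSupport k, ∑ i, c i • π i ∈ L := fun c =>
    sum_mem fun i _ => L.smul_mem (hπL i)
  obtain ⟨j₀, hj₀⟩ : ∃ j₀ : ℤ, m * a.order = j₀ := by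
    by_cases h : a = 0
    · exact ⟨0, by simp [h]⟩
    · exact hord a ha h
  -- Successive approximation: the leading term of the error is cancelled by a monomial times some
  -- π_i, with a coefficient in k. As orders lie in (1/m)ℤ, the error gains at least 1/m each time.
  have step : ∀ l : ℕ, ∃ c : ι → intSupport k,
      ((((j₀ + l : ℤ) : ℚ) / m : ℚ) : WithTop ℚ) ≤ (a - ∑ i, c i • π i).orderTop := by
    intro l
    induction l with
    | zero =>
      refine ⟨0, ?_⟩
      by_cases h : a = 0
      · simp [h]
      · simp only [Pi.zero_apply, zero_smul, Finset.sum_const_zero, sub_zero]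
        rw [← order_eq_orderTop_of_ne_zero h, WithTop.coe_le_coe, div_le_iff₀ hm0]
        push_cast
        linarith
    | succ l ih =>
      classical
      obtain ⟨c, hc⟩ := ih
      set b := a - ∑ i, c i • π i with hb
      by_cases hb0 : b = 0
      · exact ⟨c, by rw [← hb, hb0]; simp⟩
      have hbL : b ∈ L := sub_mem ha (hsum c)
      obtain ⟨i, j, hij⟩ := hex b hbL hb0
      set g := b - single (j : ℚ) (b.leadingCoeff / (π i).leadingCoeff) * π i with hg
      have hlt : (b.order : WithTop ℚ) < g.orderTop := orderTop_sub_single_mul hb0 (hπ0 i) hij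
      refine ⟨c + Pi.single i ⟨single (j : ℚ) (b.leadingCoeff / (π i).leadingCoeff),
        single_mem_intSupport _ _⟩, ?_⟩
      have hgeq : a - ∑ i', (c + Pi.single i ⟨single (j : ℚ)
          (b.leadingCoeff / (π i).leadingCoeff), single_mem_intSupport _ _⟩ :
            ι → intSupport k) i' • π i' = g := by
        simp only [Pi.add_apply, add_smul, Finset.sum_add_distrib]
        rw [Finset.sum_eq_single (f := fun i' => Pi.single (M := fun _ => intSupport k) i
          ⟨single (j : ℚ) (b.leadingCoeff / (π i).leadingCoeff), single_mem_intSupport _ _⟩ i'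
            • π i') i, Pi.single_eq_same, IntermediateField.smul_def, smul_eq_mul, hg, hb]
        · ring
        · intro i' _ hne
          rw [Pi.single_eq_of_ne hne, zero_smul]
        · exact fun h => absurd (Finset.mem_univ i) h
      rw [hgeq]
      by_cases hg0 : g = 0
      · simp [hg0]
      have hgL : g ∈ L := by rw [← hgeq]; exact sub_mem ha (hsum _)
      obtain ⟨x, hx⟩ := hord b hbL hb0
      obtain ⟨y, hy⟩ := hord g hgL hg0
      rw [← order_eq_orderTop_of_ne_zero hb0, WithTop.coe_le_coe, div_le_iff₀ hm0, mul_comm,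
        hx] at hc
      rw [← order_eq_orderTop_of_ne_zero hg0, WithTop.coe_lt_coe] at hlt
      have hlt' := mul_lt_mul_of_pos_left hlt hm0
      rw [hx, hy] at hlt'
      rw [← order_eq_orderTop_of_ne_zero hg0, WithTop.coe_le_coe, div_le_iff₀ hm0, mul_comm, hy]
      have h1 : j₀ + l ≤ x := by exact_mod_cast hc
      have h2 : x < y := by exact_mod_cast hlt'
      have h3 : j₀ + ((l + 1 : ℕ) : ℤ) ≤ y := by push_cast; omega
      exact_mod_cast h3
  refine exists_eq_sum_of_approx hπ0 hπ fun N => ?_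
  obtain ⟨l, hl⟩ := exists_nat_ge (N * m - j₀ : ℚ)
  obtain ⟨c, hc⟩ := step l
  refine ⟨c, le_trans ?_ hc⟩
  rw [WithTop.coe_le_coe, le_div_iff₀ hm0]
  push_cast
  linarith

variable (L : IntermediateField (intSupport k) (HahnSeries ℚ k))

/-- The value group of a field of Hahn series. -/
def orderGroup : AddSubgroup ℚ where
  carrier := {γ | ∃ f ∈ L, f ≠ 0 ∧ f.order = γ}
  zero_mem' := ⟨1, one_mem L, one_ne_zero, order_one⟩
  add_mem' := by
    rintro _ _ ⟨f, hf, hf0, rfl⟩ ⟨g, hg, hg0, rfl⟩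
    exact ⟨f * g, mul_mem hf hg, mul_ne_zero hf0 hg0, order_mul hf0 hg0⟩
  neg_mem' := by
    rintro _ ⟨f, hf, hf0, rfl⟩
    refine ⟨f⁻¹, inv_mem hf, inv_ne_zero hf0, ?_⟩
    have := order_mul hf0 (inv_ne_zero hf0)
    rw [mul_inv_cancel₀ hf0, order_one] at this
    linarith

/-- A finite extension of the Laurent series field inside the Hahn series is totally ramified. -/
theorem order_of_finrank [FiniteDimensional (intSupport k) L] :
    (∀ f ∈ L, f ≠ 0 → ∃ j : ℤ, Module.finrank (intSupport k) L * f.order = j) ∧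
      ∃ f ∈ L, f ≠ 0 ∧ Module.finrank (intSupport k) L * f.order = 1 := by
  classical
  set D := Module.finrank (intSupport k) L with hD
  set Z : AddSubgroup (orderGroup L) := (Int.castAddHom ℚ).range.addSubgroupOf (orderGroup L)
  have hrep : ∀ g : orderGroup L ⧸ Z, ∃ f ∈ L, f ≠ 0 ∧ f.order = (g.out : ℚ) := fun g =>
    g.out.2
  choose π hπL hπ0 hπ using hrep
  have hclass : ∀ (γ : orderGroup L), ∃ j : ℤ, (γ : ℚ) = j + (π (γ : orderGroup L ⧸ Z)).order := by
    intro γ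
    have h1 : -((γ : orderGroup L ⧸ Z)).out + γ ∈ Z :=
      QuotientAddGroup.eq.1 (Quotient.out_eq _)
    obtain ⟨j, hj⟩ := AddSubgroup.mem_addSubgroupOf.1 h1
    refine ⟨j, ?_⟩
    rw [hπ]
    have hj' : (j : ℚ) = -(((γ : orderGroup L ⧸ Z)).out : ℚ) + γ := hj
    rw [hj']
    ring
  have hincong : ∀ g g' : orderGroup L ⧸ Z, ∀ j : ℤ, (π g).order = (π g').order + j → g = g' := by
    intro g g' j h
    rw [hπ, hπ] at h
    rw [← Quotient.out_eq g, ← Quotient.out_eq g']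
    refine QuotientAddGroup.eq.2 (AddSubgroup.mem_addSubgroupOf.2 ⟨-j, ?_⟩)
    change ((-j : ℤ) : ℚ) = -(g.out : ℚ) + g'.out
    rw [h]
    push_cast
    ring
  have hli := linearIndependent_of_order hπ0 hincong
  have hliL : LinearIndependent (intSupport k) fun g => (⟨π g, hπL g⟩ : L) :=
    LinearIndependent.of_comp L.val.toLinearMap hli
  have hfin : Finite (orderGroup L ⧸ Z) := hliL.finite
  have := Fintype.ofFinite (orderGroup L ⧸ Z)
  have hcpos : 0 < Fintype.card (orderGroup L ⧸ Z) := Fintype.card_pos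
  have hcard_nsmul : ∀ f ∈ L, f ≠ 0 →
      ∃ j : ℤ, (Fintype.card (orderGroup L ⧸ Z) : ℕ) * f.order = j := by
    intro f hf hf0
    set γ : orderGroup L := ⟨f.order, f, hf, hf0, rfl⟩ with hγ
    have h1 : ((Fintype.card (orderGroup L ⧸ Z) • γ : orderGroup L) : orderGroup L ⧸ Z) = 0 := by
      rw [QuotientAddGroup.mk_nsmul, card_nsmul_eq_zero]
    obtain ⟨j, hj⟩ := AddSubgroup.mem_addSubgroupOf.1 ((QuotientAddGroup.eq_zero_iff _).1 h1)
    refine ⟨j, ?_⟩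
    have hj' : (j : ℚ) = Fintype.card (orderGroup L ⧸ Z) • f.order := hj
    rw [hj', nsmul_eq_mul]
  have hspan : ⊤ ≤ Submodule.span (intSupport k)
      (Set.range fun g => (⟨π g, hπL g⟩ : L)) := by
    rintro ⟨a, ha⟩ -
    obtain ⟨c, hc⟩ := exists_eq_sum_of_orders hπ0 hincong hπL (fun f hf hf0 =>
      ⟨_, hclass ⟨f.order, f, hf, hf0, rfl⟩⟩) hcpos hcard_nsmul ha
    have : (⟨a, ha⟩ : L) = ∑ g, c g • (⟨π g, hπL g⟩ : L) := by
      refine Subtype.ext ?_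
      rw [AddSubmonoidClass.coe_finsetSum]
      exact hc
    rw [this]
    exact sum_mem fun g _ => Submodule.smul_mem _ _ (Submodule.subset_span ⟨g, rfl⟩)
  -- Representatives of the value group modulo ℤ form a basis, so the ramification index is the
  -- degree.
  have hcard : Fintype.card (orderGroup L ⧸ Z) = D :=
    (Module.finrank_eq_card_basis (Module.Basis.mk hliL hspan)).symm
  rw [hcard] at hcard_nsmul hcpos
  refine ⟨hcard_nsmul, ?_⟩
  have hD0 : (D : ℚ) ≠ 0 := by exact_mod_cast hcpos.ne'
  have : NeZero D := ⟨hcpos.ne'⟩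
  choose num hnum using fun g => hcard_nsmul (π g) (hπL g) (hπ0 g)
  -- The D representatives have orders with distinct numerators mod D, so one numerator is 1 mod D.
  -- A power of t corrects its order to exactly 1/D.
  have hinj : Function.Injective fun g => (num g : ZMod D) := by
    intro g g' h
    obtain ⟨j, hj⟩ := (ZMod.intCast_eq_intCast_iff_dvd_sub _ _ _).1 h.symm
    refine hincong g g' j (mul_left_cancel₀ hD0 ?_)
    rw [mul_add, hnum, hnum, ← sub_eq_iff_eq_add']
    exact_mod_cast hj
  obtain ⟨g, hg⟩ := ((Fintype.bijective_iff_injective_and_card _).2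
    ⟨hinj, by rw [hcard, ZMod.card]⟩).2 1
  obtain ⟨j, hj⟩ : (D : ℤ) ∣ 1 - num g := by
    refine (ZMod.intCast_eq_intCast_iff_dvd_sub _ _ _).1 ?_
    simpa using hg
  have hs0 : single (j : ℚ) (1 : k) ≠ 0 := single_ne_zero one_ne_zero
  refine ⟨single (j : ℚ) 1 * π g, mul_mem ?_ (hπL g), mul_ne_zero hs0 (hπ0 g), ?_⟩
  · exact L.algebraMap_mem ⟨_, single_mem_intSupport j 1⟩
  · rw [order_mul hs0 (hπ0 g), order_single one_ne_zero, mul_add, hnum]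
    have : (1 : ℤ) = D * j + num g := by linarith
    exact_mod_cast this.symm

end Ramification

/-! ### Discrete valuations -/

section Valuations

theorem valuation_aeval_le_one {k E Γ : Type*} [Field k] [CommRing E] [Algebra k E]
    [LinearOrderedCommGroupWithZero Γ] (v : Valuation E Γ)
    (hv : ∀ c : k, c ≠ 0 → v (algebraMap k E c) = 1) {a : E} (ha : v a ≤ 1) (f : k[X]) :
    v (aeval a f) ≤ 1 := by
  rw [aeval_eq_sum_range]
  refine v.map_sum_le fun i _ => ?_
  rw [Algebra.smul_def, map_mul, map_pow]
  by_cases h : f.coeff i = 0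
  · simp [h]
  · rw [hv _ h, one_mul]
    exact pow_le_one₀ zero_le ha

theorem valuation_aeval_of_one_lt {k E Γ : Type*} [Field k] [CommRing E] [Algebra k E]
    [LinearOrderedCommGroupWithZero Γ] (v : Valuation E Γ)
    (hv : ∀ c : k, c ≠ 0 → v (algebraMap k E c) = 1) {a : E} (ha : 1 < v a) {f : k[X]}
    (hf : f ≠ 0) : v (aeval a f) = v a ^ f.natDegree := by
  have hlead : v (f.coeff f.natDegree • a ^ f.natDegree) = v a ^ f.natDegree := by
    rw [Algebra.smul_def, map_mul, map_pow, hv (f.coeff f.natDegree) (leadingCoeff_ne_zero.2 hf), one_mul]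
  have hpos : 0 < v a := zero_lt_one.trans ha
  rw [aeval_eq_sum_range, Finset.sum_range_succ, Valuation.map_add_eq_of_lt_right, hlead]
  rw [hlead]
  refine v.map_sum_lt (pow_pos hpos _).ne' fun i hi => ?_
  rw [Algebra.smul_def, map_mul, map_pow]
  by_cases h : f.coeff i = 0
  · simp only [h, map_zero, zero_mul]
    exact pow_pos hpos _
  · rw [hv _ h, one_mul]
    exact pow_lt_pow_right₀ ha (Finset.mem_range.1 hi)

/-- Units of v are units of w, so w is determined by its value at a uniformizer of v; surjectivity
of w forces that value to be exp(-1). -/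
theorem eq_of_le_one {E : Type*} [Field E] {v w : Valuation E ℤᵐ⁰} (hv : Function.Surjective v)
    (hw : Function.Surjective w) (h : ∀ f, v f ≤ 1 → w f ≤ 1) : v = w := by
  have h1 : ∀ f, v f = 1 → w f = 1 := by
    intro f hf
    refine le_antisymm (h f hf.le) ?_
    have h2 := h f⁻¹ (by rw [map_inv₀, hf, inv_one])
    have hf0 : w f ≠ 0 := by
      rw [Valuation.ne_zero_iff]
      rintro rfl
      simp at hf
    rwa [map_inv₀, inv_le_one₀ (zero_lt_iff.2 hf0)] at h2
  obtain ⟨π, hπ⟩ := hv (WithZero.exp (-1))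
  have hπ0 : π ≠ 0 := by
    rintro rfl
    rw [map_zero] at hπ
    exact WithZero.exp_ne_zero hπ.symm
  have h3 : ∀ f, f ≠ 0 → w f = w π ^ (-WithZero.log (v f)) := by
    intro f hf
    have hvf : v f ≠ 0 := (Valuation.ne_zero_iff _).2 hf
    have := h1 (f * π ^ (WithZero.log (v f))) (by
      rw [map_mul, map_zpow₀, hπ, ← WithZero.exp_zsmul, smul_eq_mul, mul_neg_one,
        WithZero.exp_neg, WithZero.exp_log hvf, mul_inv_cancel₀ hvf])
    rw [map_mul, map_zpow₀] at this
    rw [zpow_neg]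
    exact eq_inv_of_mul_eq_one_left this
  have hwπ : w π ≠ 0 := (Valuation.ne_zero_iff _).2 hπ0
  have hπ1 : w π = WithZero.exp (-1) := by
    obtain ⟨f, hf⟩ := hw (WithZero.exp (-1))
    have hf0 : f ≠ 0 := by
      rintro rfl
      rw [map_zero] at hf
      exact WithZero.exp_ne_zero hf.symm
    have h4 := congrArg WithZero.log (h3 f hf0)
    rw [hf, WithZero.log_exp, WithZero.log_zpow] at h4
    have h5 : WithZero.log (w π) ≤ 0 := by
      have := h π (by rw [hπ, ← WithZero.exp_zero, WithZero.exp_le_exp]; norm_num)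
      rwa [← WithZero.exp_log hwπ, ← WithZero.exp_zero, WithZero.exp_le_exp] at this
    have h6 : WithZero.log (w π) = -1 := by
      rw [smul_eq_mul] at h4
      have h7 : WithZero.log (w π) ∣ 1 :=
        (dvd_neg (a := WithZero.log (w π))).1 (h4 ▸ dvd_mul_left _ _)
      rcases Int.isUnit_iff.1 (isUnit_of_dvd_one h7) with h8 | h8 <;> omega
    rw [← WithZero.exp_log hwπ, h6]
  ext f
  by_cases hf : f = 0
  · simp [hf]
  · have hvf : v f ≠ 0 := (Valuation.ne_zero_iff _).2 hf
    rw [h3 f hf, hπ1, ← WithZero.exp_zsmul, smul_eq_mul, neg_mul_neg, mul_one,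
      WithZero.exp_log hvf]

variable {k E : Type*} [Field k] [Field E]

/-- The valuation induced by an embedding into the Hahn series whose orders lie in `(1 / D) ℤ`. -/
noncomputable def orderValuation (ψ : E →+* HahnSeries ℚ k) (D : ℕ)
    (hψ : ∀ f, ∃ j : ℤ, D * (ψ f).order = j) : Valuation E ℤᵐ⁰ where
  -- The floor only serves to view as an integer a rational number that is one by `hψ`.
  toFun f := open Classical in if f = 0 then 0 else WithZero.exp (-⌊D * (ψ f).order⌋)
  map_zero' := if_pos rfl
  map_one' := by simp
  map_mul' f g := by
    by_cases hf : f = 0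
    · simp [hf]
    by_cases hg : g = 0
    · simp [hg]
    obtain ⟨i, hi⟩ := hψ f
    obtain ⟨j, hj⟩ := hψ g
    have hf' : ψ f ≠ 0 := (map_ne_zero ψ).2 hf
    have hg' : ψ g ≠ 0 := (map_ne_zero ψ).2 hg
    rw [if_neg hf, if_neg hg, if_neg (mul_ne_zero hf hg), map_mul, HahnSeries.order_mul hf' hg',
      mul_add, hi, hj, ← Int.cast_add, Int.floor_intCast, Int.floor_intCast, Int.floor_intCast,
      neg_add, WithZero.exp_add]
  map_add_le_max' f g := by
    by_cases hf : f = 0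
    · subst hf
      rw [zero_add, if_pos rfl]
      exact le_max_right _ _
    by_cases hg : g = 0
    · subst hg
      rw [add_zero, if_pos rfl]
      exact le_max_left _ _
    by_cases hfg : f + g = 0
    · simp [hfg]
    have h := HahnSeries.min_order_le_order_add (x := ψ f) (y := ψ g)
      (by rw [← map_add]; exact (map_ne_zero ψ).2 hfg)
    rw [if_neg hf, if_neg hg, if_neg hfg, map_add, le_max_iff, WithZero.exp_le_exp,
      WithZero.exp_le_exp, neg_le_neg_iff, neg_le_neg_iff]
    have hD : (0 : ℚ) ≤ D := Nat.cast_nonneg D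
    rcases min_le_iff.1 h with h | h
    · exact Or.inl (Int.floor_le_floor (mul_le_mul_of_nonneg_left h hD))
    · exact Or.inr (Int.floor_le_floor (mul_le_mul_of_nonneg_left h hD))

theorem orderValuation_apply {ψ : E →+* HahnSeries ℚ k} {D : ℕ}
    {hψ : ∀ f, ∃ j : ℤ, D * (ψ f).order = j} {f : E} (hf : f ≠ 0) {j : ℤ}
    (hj : D * (ψ f).order = j) : orderValuation ψ D hψ f = WithZero.exp (-j) := by
  classical
  change (if f = 0 then 0 else WithZero.exp (-⌊D * (ψ f).order⌋)) = _
  rw [if_neg hf, hj, Int.floor_intCast]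

end Valuations

/-! ### Approximating Laurent series by Laurent polynomials in x -/

section Approximation

open HahnSeries

variable {k : Type*} [Field k]

theorem aeval_single_neg_one (f : k[X]) (hf : f ≠ 0) :
    aeval (single (-1 : ℚ) (1 : k)) f ≠ 0 ∧
      (aeval (single (-1 : ℚ) (1 : k)) f).order = -f.natDegree := by
  have h1 : ∀ γ, (aeval (single (-1 : ℚ) (1 : k)) f).coeff γ =
      ∑ i ∈ Finset.range (f.natDegree + 1), if γ = -i then f.coeff i else 0 := by
    intro γ
    rw [aeval_eq_sum_range, HahnSeries.coeff_sum]
    refine Finset.sum_congr rfl fun i _ => ?_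
    rw [HahnSeries.coeff_smul, single_pow, one_pow, HahnSeries.coeff_single]
    simp
  have h2 : (aeval (single (-1 : ℚ) (1 : k)) f).coeff (-f.natDegree) ≠ 0 := by
    rw [h1, Finset.sum_eq_single f.natDegree]
    · simpa using hf
    · intro i _ hi
      rw [if_neg]
      intro h
      rw [neg_inj] at h
      exact hi (by exact_mod_cast h.symm)
    · simp
  have h0 := ne_zero_of_coeff_ne_zero h2
  refine ⟨h0, le_antisymm (order_le_of_coeff_ne_zero h2) ?_⟩
  rw [le_order_iff_forall h0]
  intro γ hγ
  rw [h1]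
  refine Finset.sum_eq_zero fun i hi => if_neg ?_
  rintro rfl
  rw [neg_lt_neg_iff, Nat.cast_lt] at hγ
  rw [Finset.mem_range] at hi
  omega

theorem exists_approx {S : IntermediateField k (HahnSeries ℚ k)}
    (hS : single (-1 : ℚ) (1 : k) ∈ S) {c : HahnSeries ℚ k} (hc : c ∈ intSupport k) (M : ℤ) :
    ∃ c' ∈ S, ((M : ℚ) : WithTop ℚ) ≤ (c - c').orderTop := by
  obtain ⟨j₀, hj₀⟩ := exists_order_eq_intCast hc
  refine ⟨∑ j ∈ Finset.Ico j₀ M, single (j : ℚ) (c.coeff j), sum_mem fun j _ => ?_, ?_⟩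
  · have h : single (j : ℚ) (c.coeff j) = c.coeff j • (single (-1 : ℚ) (1 : k)) ^ (-j) := by
      have h1 : single (-1 : ℚ) (1 : k) = (single (1 : ℚ) (1 : k))⁻¹ := by
        rw [inv_single, inv_one]
      have h2 : ∀ m : ℕ, single (1 : ℚ) (1 : k) ^ m = single (m : ℚ) 1 := fun m => by
        rw [single_pow, one_pow, nsmul_eq_mul, mul_one]
      rw [h1, inv_zpow', neg_neg]
      have h3 : single (1 : ℚ) (1 : k) ^ j = single (j : ℚ) 1 := by
        obtain ⟨m, rfl | rfl⟩ := j.eq_nat_or_neg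
        · rw [zpow_natCast, h2, Int.cast_natCast]
        · rw [zpow_neg, zpow_natCast, h2, inv_single, inv_one]; push_cast; rfl
      rw [h3, Algebra.smul_def, HahnSeries.algebraMap_apply, HahnSeries.C_apply, single_mul_single,
        zero_add, mul_one]
      rfl
    rw [h]
    exact S.smul_mem (zpow_mem hS _)
  · rw [le_orderTop_iff_forall]
    intro γ hγ
    have hγM : γ < M := WithTop.coe_lt_coe.1 hγ
    rw [HahnSeries.coeff_sub, HahnSeries.coeff_sum]
    by_cases h : ∃ j : ℤ, γ = j
    · obtain ⟨j, rfl⟩ := h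
      by_cases hj : j₀ ≤ j
      · rw [Finset.sum_eq_single j]
        · rw [coeff_single_same, sub_self]
        · intro i _ hij
          exact coeff_single_of_ne (by exact_mod_cast hij.symm)
        · intro h'
          exact absurd (Finset.mem_Ico.2 ⟨hj, by exact_mod_cast hγM⟩) h'
      · rw [coeff_eq_zero_of_lt_order (by rw [hj₀]; exact_mod_cast not_le.1 hj), zero_sub,
          Finset.sum_eq_zero, neg_zero]
        intro i hi
        refine coeff_single_of_ne ?_
        have := (Finset.mem_Ico.1 hi).1
        have : j ≠ i := by omega
        exact_mod_cast this
    · push Not at h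
      rw [coeff_eq_zero_of_mem_intSupport hc h, zero_sub, Finset.sum_eq_zero, neg_zero]
      exact fun i _ => coeff_single_of_ne (h i)

end Approximation

/-! ### The coordinate ring inside Hahn series -/

section Embedding

open HahnSeries IntermediateField

variable {k : Type*} [Field k] {P : k[X][X]} {Y : HahnSeries ℚ k}

variable (k) in
/-- The function `x`, as a Hahn series in `t = x⁻¹`. -/
noncomputable def xSeries : HahnSeries ℚ k := single (-1) 1

variable (k) in
theorem xSeries_mem_intSupport : xSeries k ∈ intSupport k := by
  have := single_mem_intSupport (k := k) (-1) 1
  push_cast at this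
  exact this

/-- The defining polynomial, with coefficients in an intermediate field that contains `x`. -/
noncomputable def overField (P : k[X][X]) (K : IntermediateField k (HahnSeries ℚ k))
    (hK : xSeries k ∈ K) : K[X] :=
  P.map (aeval (⟨xSeries k, hK⟩ : K)).toRingHom

theorem aeval_overField {K : IntermediateField k (HahnSeries ℚ k)} {hK : xSeries k ∈ K} :
    aeval Y (overField P K hK) = P.eval₂ (aeval (xSeries k)).toRingHom Y := by
  rw [overField, aeval_def, eval₂_map]
  congr 1
  ext a
  · simp
  · simp

theorem aeval_xSeries_injective {K : IntermediateField k (HahnSeries ℚ k)} {hK : xSeries k ∈ K} :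
    Function.Injective (aeval (R := k) (⟨xSeries k, hK⟩ : K)).toRingHom := by
  rw [injective_iff_map_eq_zero]
  intro f hf
  by_contra h0
  refine (aeval_single_neg_one f h0).1 ?_
  have := congrArg (algebraMap K (HahnSeries ℚ k)) hf
  rw [map_zero] at this
  exact (aeval_algebraMap_apply (HahnSeries ℚ k) (⟨xSeries k, hK⟩ : K) f).trans this

variable (hP : P.Monic) (hY : P.eval₂ (aeval (xSeries k)).toRingHom Y = 0)
  (hdeg : (minpoly (intSupport k) Y).natDegree = P.natDegree)

include hP hY in
theorem isIntegral_of_overField {K : IntermediateField k (HahnSeries ℚ k)} (hK : xSeries k ∈ K) :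
    IsIntegral K Y :=
  ⟨overField P K hK, hP.map _, by rw [← aeval_def, aeval_overField, hY]⟩

/-- The homomorphism from the coordinate ring to the Hahn series. -/
noncomputable def coordHom : AdjoinRoot P →+* HahnSeries ℚ k :=
  AdjoinRoot.lift (aeval (xSeries k)).toRingHom Y hY

include hP hdeg in
-- A nonzero remainder modulo P has degree less than P, hence less than the minimal polynomial of Y,
-- so it cannot vanish at Y.
theorem coordHom_injective : Function.Injective (coordHom hY) := by
  rw [injective_iff_map_eq_zero]
  intro a ha
  obtain ⟨f, rfl⟩ := AdjoinRoot.mk_surjective a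
  have hmk : AdjoinRoot.mk P f = AdjoinRoot.mk P (f %ₘ P) := by
    rw [AdjoinRoot.mk_eq_mk, modByMonic_eq_sub_mul_div f P, sub_sub_cancel]
    exact dvd_mul_right _ _
  rw [hmk] at ha ⊢
  by_cases hP1 : P = 1
  · rw [hP1, modByMonic_one, map_zero]
  rw [coordHom, AdjoinRoot.lift_mk] at ha
  have hlt := natDegree_modByMonic_lt f hP hP1
  set g := f %ₘ P
  suffices g = 0 by rw [this, map_zero]
  rw [← aeval_overField (hK := xSeries_mem_intSupport k)] at ha
  by_contra hg
  have hg' : overField g (intSupport k) (xSeries_mem_intSupport k) ≠ 0 :=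
    (Polynomial.map_ne_zero_iff aeval_xSeries_injective).2 hg
  have h1 := natDegree_le_natDegree (minpoly.degree_le_of_ne_zero (intSupport k) Y hg' ha)
  rw [hdeg, overField, natDegree_map_eq_of_injective aeval_xSeries_injective] at h1
  omega

end Embedding

/-! ### The unique pole of x -/

section Places

open HahnSeries IntermediateField

variable {k E : Type*} [Field k] [Field E] [Algebra k E] {P : k[X][X]} {Y : HahnSeries ℚ k}
  {ψ : E →ₐ[k] HahnSeries ℚ k} {x : E}
  (hP : P.Monic) (hY : P.eval₂ (aeval (xSeries k)).toRingHom Y = 0)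
  (hdeg : (minpoly (intSupport k) Y).natDegree = P.natDegree)
  (hx : ψ x = xSeries k) (hYψ : Y ∈ ψ.fieldRange)
  (hgen : ψ.fieldRange ≤ IntermediateField.adjoin k {xSeries k, Y})

include hgen in
theorem mem_adjoin_of_gen {K : IntermediateField k (HahnSeries ℚ k)} (hK : xSeries k ∈ K) (f : E) :
    ψ f ∈ K⟮Y⟯ := by
  have h : IntermediateField.adjoin k {xSeries k, Y} ≤ (K⟮Y⟯).restrictScalars k := by
    rw [adjoin_le_iff]
    rintro a (rfl | rfl)
    · exact (K⟮Y⟯).algebraMap_mem ⟨_, hK⟩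
    · exact mem_adjoin_simple_self K a
  exact h (hgen ⟨f, rfl⟩)

include hP hY hdeg in
theorem natDegree_pos_of_minpoly : 0 < P.natDegree := by
  rw [← hdeg]
  exact minpoly.natDegree_pos (isIntegral_of_overField hP hY (xSeries_mem_intSupport k))

include hP hY hdeg hgen in
theorem exists_natDegree_mul_order_eq (f : E) : ∃ j : ℤ, P.natDegree * (ψ f).order = j := by
  have hint := isIntegral_of_overField hP hY (xSeries_mem_intSupport k)
  have := adjoin.finiteDimensional hint
  by_cases hf : ψ f = 0
  · exact ⟨0, by simp [hf]⟩
  · rw [← hdeg, ← adjoin.finrank hint]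
    exact (order_of_finrank _).1 _ (mem_adjoin_of_gen hgen (xSeries_mem_intSupport k) f) hf

include hP hY hdeg hx hYψ in
-- Total ramification gives an element G(Y) of order 1/deg P over the Laurent series. Replacing the
-- coefficients of G by close enough Laurent polynomials in x keeps the order and lands in the
-- function field.
theorem exists_uniformizer : ∃ π : E, π ≠ 0 ∧ P.natDegree * (ψ π).order = 1 := by
  have hint := isIntegral_of_overField hP hY (xSeries_mem_intSupport k)
  have := adjoin.finiteDimensional hint
  obtain ⟨f, hf, hf0, hord⟩ := (order_of_finrank (intSupport k)⟮Y⟯).2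
  rw [adjoin.finrank hint, hdeg] at hord
  have hf' : f ∈ (intSupport k)⟮Y⟯.toSubalgebra := hf
  rw [adjoin_simple_toSubalgebra_of_isAlgebraic hint.isAlgebraic,
    Algebra.adjoin_singleton_eq_range_aeval] at hf'
  obtain ⟨G, rfl⟩ := hf'
  change aeval Y G ≠ 0 at hf0
  change P.natDegree * (aeval Y G).order = 1 at hord
  have hY0 : ∃ A : ℕ, ∀ i ∈ Finset.range (G.natDegree + 1), |i * Y.order| ≤ A := by
    obtain ⟨A, hA⟩ := exists_nat_ge (∑ i ∈ Finset.range (G.natDegree + 1), |i * Y.order|)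
    exact ⟨A, fun i hi => (Finset.single_le_sum (f := fun i : ℕ => |i * Y.order|)
      (fun _ _ => abs_nonneg _) hi).trans hA⟩
  obtain ⟨A, hA⟩ := hY0
  obtain ⟨B, hB⟩ := exists_nat_ge (aeval Y G).order
  have hxS : single (-1 : ℚ) (1 : k) ∈ ψ.fieldRange := ⟨x, hx⟩
  -- Multiplication by Y^i lowers the precision by at most A, so the error has order at least B + 1,
  -- beyond the order of G(Y).
  choose c hcS hc using fun i => exists_approx hxS (G.coeff i).2 (A + B + 1)
  have hsum : ∑ i ∈ Finset.range (G.natDegree + 1), c i * Y ^ i ∈ ψ.fieldRange :=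
    sum_mem fun i _ => mul_mem (hcS i) (pow_mem hYψ i)
  obtain ⟨π, hπ⟩ := hsum
  change ψ π = _ at hπ
  have hlt : ((aeval Y G).order : WithTop ℚ) < (aeval Y G - ψ π).orderTop := by
    rw [hπ, aeval_eq_sum_range, ← Finset.sum_sub_distrib, ← aeval_eq_sum_range]
    refine lt_of_lt_of_le (b := (((B : ℚ) + 1 : ℚ) : WithTop ℚ)) ?_ ?_
    · rw [WithTop.coe_lt_coe]
      linarith
    · rw [le_orderTop_iff_forall]
      intro γ hγ
      rw [HahnSeries.coeff_sum]
      refine Finset.sum_eq_zero fun i hi => coeff_eq_zero_of_lt_orderTop (lt_of_lt_of_le hγ ?_)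
      rw [IntermediateField.smul_def, smul_eq_mul, ← sub_mul, orderTop_mul]
      by_cases hYi : Y ^ i = 0
      · simp [hYi]
      · refine le_trans ?_ (add_le_add_left (hc i) _)
        rw [← order_eq_orderTop_of_ne_zero hYi, ← WithTop.coe_add, WithTop.coe_le_coe, order_pow,
          nsmul_eq_mul]
        push_cast
        linarith [neg_le_of_abs_le (hA i hi)]
  have hcoeff : ∀ γ : ℚ, γ ≤ (aeval Y G).order → (ψ π).coeff γ = (aeval Y G).coeff γ := by
    intro γ hγ
    have := coeff_eq_zero_of_lt_orderTop (lt_of_le_of_lt (WithTop.coe_le_coe.2 hγ) hlt)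
    rw [HahnSeries.coeff_sub] at this
    exact (sub_eq_zero.1 this).symm
  have hne : (ψ π).coeff (aeval Y G).order ≠ 0 := by
    rw [hcoeff _ le_rfl]
    exact fun h => hf0 (coeff_order_eq_zero.1 h)
  have hπ0 := ne_zero_of_coeff_ne_zero hne
  refine ⟨π, fun h => hπ0 (by rw [h, map_zero]), ?_⟩
  rw [← hord]
  congr 1
  refine le_antisymm (order_le_of_coeff_ne_zero hne) ((le_order_iff_forall hπ0).2 fun γ hγ => ?_)
  rw [hcoeff γ hγ.le]
  exact coeff_eq_zero_of_lt_order hγ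

include hx in
/-- A rational function in `x` of nonnegative order is integral at every place where `x` has a
pole. -/
theorem exists_integral_of_mem_adjoin {c : HahnSeries ℚ k}
    (hc : c ∈ IntermediateField.adjoin k {xSeries k}) (h0 : 0 ≤ c.order) :
    ∃ e : E, ψ e = c ∧ ∀ w : Valuation E ℤᵐ⁰,
      (∀ a : k, a ≠ 0 → w (algebraMap k E a) = 1) → 1 < w x → w e ≤ 1 := by
  by_cases hc0 : c = 0
  · exact ⟨0, by rw [hc0, map_zero], fun w _ _ => by rw [map_zero]; exact zero_le⟩
  obtain ⟨a, b, rfl⟩ := mem_adjoin_simple_iff k c |>.1 hc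
  have ha : a ≠ 0 := by rintro rfl; simp at hc0
  have hb : b ≠ 0 := by rintro rfl; simp at hc0
  obtain ⟨ha0, hao⟩ := aeval_single_neg_one a ha
  obtain ⟨hb0, hbo⟩ := aeval_single_neg_one b hb
  change (aeval (xSeries k) a).order = _ at hao
  change (aeval (xSeries k) b).order = _ at hbo
  have h1 := order_mul hc0 hb0
  change (aeval (xSeries k) a / aeval (xSeries k) b * aeval (xSeries k) b).order =
    _ + (aeval (xSeries k) b).order at h1
  rw [div_mul_cancel₀ _ (show aeval (xSeries k) b ≠ 0 from hb0), hao, hbo] at h1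
  have hab : a.natDegree ≤ b.natDegree := by
    have : (a.natDegree : ℚ) ≤ b.natDegree := by linarith
    exact_mod_cast this
  refine ⟨aeval x a / aeval x b, ?_, fun w hw hwx => ?_⟩
  · rw [map_div₀, ← aeval_algHom_apply, ← aeval_algHom_apply, hx]
  · rw [map_div₀, valuation_aeval_of_one_lt w hw hwx ha, valuation_aeval_of_one_lt w hw hwx hb]
    refine div_le_one_of_le₀ (pow_le_pow_right₀ hwx.le hab) zero_le

include hP hY hdeg hgen in
/-- The powers of a uniformizer form a basis of the function field over the rational functions. -/
theorem exists_eq_sum_pow {π : E} (hπ0 : π ≠ 0) (hπ : P.natDegree * (ψ π).order = 1) (f : E) :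
    ∃ c : Fin P.natDegree → HahnSeries ℚ k,
      (∀ i, c i ∈ IntermediateField.adjoin k {xSeries k}) ∧ ψ f = ∑ i, c i * ψ π ^ (i : ℕ) ∧
        ∀ i, c i ≠ 0 → (ψ f).orderTop ≤ ((c i).order + (i : ℕ) * (ψ π).order : ℚ) := by
  set D := P.natDegree with hD
  have hDpos : 0 < D := natDegree_pos_of_minpoly hP hY hdeg
  have hD0 : (D : ℚ) ≠ 0 := by exact_mod_cast hDpos.ne'
  have hψπ : ψ π ≠ 0 := (_root_.map_ne_zero ψ).2 hπ0
  have hp0 : ∀ i : Fin D, ψ π ^ (i : ℕ) ≠ 0 := fun i => pow_ne_zero _ hψπ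
  have hinc : ∀ i i' : Fin D, ∀ j : ℤ,
      (ψ π ^ (i : ℕ)).order = (ψ π ^ (i' : ℕ)).order + j → i = i' := by
    intro i i' j h
    rw [order_pow, order_pow, nsmul_eq_mul, nsmul_eq_mul] at h
    have h1 : ((i : ℕ) : ℚ) = (i' : ℕ) + D * j := by
      linear_combination (D : ℚ) * h + (((i' : ℕ) : ℚ) - (i : ℕ)) * hπ
    have h2 : ((i : ℕ) : ℤ) = (i' : ℕ) + D * j := by exact_mod_cast h1
    have h3 : (i : ℕ) ≡ (i' : ℕ) [MOD D] := by
      rw [← Int.natCast_modEq_iff, h2]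
      simp [Int.ModEq]
    exact Fin.ext (Nat.ModEq.eq_of_lt_of_lt h3 i.2 i'.2)
  set K := IntermediateField.adjoin k {xSeries k} with hKdef
  have hxK : xSeries k ∈ K := mem_adjoin_simple_self k _
  have hKint : K ≤ intSupport k := by
    rw [hKdef, adjoin_simple_le_iff]
    exact xSeries_mem_intSupport k
  have hmin : ∀ c : Fin D → K, ∀ i,
      (∑ i, c i • ψ π ^ (i : ℕ)).orderTop ≤ (c i • ψ π ^ (i : ℕ)).orderTop := fun c i =>
    orderTop_sum_smul_le hp0 hinc (fun i => ⟨c i, hKint (c i).2⟩) (Finset.mem_univ i)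
  have hint := isIntegral_of_overField hP hY hxK
  have := adjoin.finiteDimensional hint
  have hmem : ∀ f, ψ f ∈ K⟮Y⟯ := mem_adjoin_of_gen hgen hxK
  have hli : LinearIndependent K fun i : Fin D => (⟨ψ π, hmem π⟩ : K⟮Y⟯) ^ (i : ℕ) := by
    rw [Fintype.linearIndependent_iff]
    intro c hc i
    have h1 : ∑ i, c i • ψ π ^ (i : ℕ) = 0 := by
      have := congrArg (algebraMap K⟮Y⟯ (HahnSeries ℚ k)) hc
      rw [map_sum, map_zero] at this
      exact this
    have h2 := hmin c i
    rw [h1, orderTop_zero, top_le_iff, orderTop_eq_top, IntermediateField.smul_def, smul_eq_mul,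
      mul_eq_zero] at h2
    exact Subtype.ext (h2.resolve_right (hp0 i))
  -- P vanishes at Y, so D independent powers of π already span.
  have hfr : Module.finrank K K⟮Y⟯ ≤ D := by
    rw [adjoin.finrank hint]
    have hmon : (overField P K hxK).Monic := hP.map _
    have := natDegree_le_natDegree (minpoly.degree_le_of_ne_zero K Y hmon.ne_zero
      (by rw [aeval_overField, hY]))
    exact this.trans (natDegree_map_le)
  have hspan := hli.span_eq_top_of_card_eq_finrank' (by
    refine le_antisymm hli.fintype_card_le_finrank ?_
    rw [Fintype.card_fin]
    exact hfr)
  have hf : (⟨ψ f, hmem f⟩ : K⟮Y⟯) ∈ Submodule.span K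
      (Set.range fun i : Fin D => (⟨ψ π, hmem π⟩ : K⟮Y⟯) ^ (i : ℕ)) := by
    rw [hspan]
    exact Submodule.mem_top
  obtain ⟨c, hc⟩ := (Submodule.mem_span_range_iff_exists_fun K).1 hf
  have hc' : ψ f = ∑ i, c i • ψ π ^ (i : ℕ) := by
    have := congrArg (algebraMap K⟮Y⟯ (HahnSeries ℚ k)) hc
    rw [map_sum] at this
    exact this.symm
  refine ⟨fun i => c i, fun i => (c i).2, hc', fun i hi => ?_⟩
  have h2 := hmin c i
  rw [← hc', IntermediateField.smul_def, smul_eq_mul, orderTop_mul,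
    ← order_eq_orderTop_of_ne_zero hi, ← order_eq_orderTop_of_ne_zero (hp0 i), order_pow,
    nsmul_eq_mul, ← WithTop.coe_add] at h2
  exact h2

include hP hY hdeg hx hYψ hgen in
/-- There is exactly one place at which `x` has a pole, and it is totally ramified. -/
theorem exists_unique_place : ∃ Q : Place k E, Q.val x = WithZero.exp (P.natDegree : ℤ) ∧
    ∀ Q' : Place k E, 1 < Q'.val x → Q' = Q := by
  obtain ⟨π, hπ0, hπ⟩ := exists_uniformizer hP hY hdeg hx hYψ
  set D := P.natDegree with hD
  have hDpos : 0 < D := natDegree_pos_of_minpoly hP hY hdeg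
  have hDq : (0 : ℚ) < D := by exact_mod_cast hDpos
  set v := orderValuation (ψ : E →+* HahnSeries ℚ k) D
    (exists_natDegree_mul_order_eq hP hY hdeg hgen) with hv
  have hvapp : ∀ f, f ≠ 0 → ∀ j : ℤ, D * (ψ f).order = j → v f = WithZero.exp (-j) :=
    fun f hf j hj => orderValuation_apply hf hj
  have hvπ : v π = WithZero.exp (-1) := hvapp π hπ0 1 (by rw [hπ]; simp)
  have hsurj : Function.Surjective v := by
    intro a
    by_cases ha : a = 0
    · exact ⟨0, by rw [ha, map_zero]⟩
    · refine ⟨π ^ (-WithZero.log a), ?_⟩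
      rw [map_zpow₀, hvπ, ← WithZero.exp_zsmul, smul_eq_mul, neg_mul_neg, mul_one,
        WithZero.exp_log ha]
  have hconst : ∀ c : k, c ≠ 0 → v (algebraMap k E c) = 1 := by
    intro c hc
    have h1 : (ψ (algebraMap k E c)).order = 0 := by
      rw [AlgHom.commutes, HahnSeries.algebraMap_apply, order_C]
    rw [hvapp _ ((_root_.map_ne_zero _).2 hc) 0 (by rw [h1]; simp), neg_zero, WithZero.exp_zero]
  have hx0 : x ≠ 0 := by
    rintro rfl
    rw [map_zero] at hx
    exact single_ne_zero one_ne_zero hx.symm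
  refine ⟨⟨v, hsurj, hconst⟩, ?_, fun Q' hQ' => ?_⟩
  · change v x = _
    rw [hvapp x hx0 (-D), neg_neg]
    rw [hx, xSeries, order_single one_ne_zero]
    push_cast
    ring
  · obtain ⟨w, hws, hwc⟩ := Q'
    change 1 < w x at hQ'
    -- In the expansion of f in powers π^i with i < D, each coefficient has integral order greater
    -- than -1, hence nonnegative; such a rational function of x is w-integral.
    have hwle : ∀ f : E, (0 : WithTop ℚ) ≤ (ψ f).orderTop →
        ∃ e : Fin D → E, (∀ i, w (e i) ≤ 1) ∧ f = ∑ i, e i * π ^ (i : ℕ) := by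
      intro f hf
      obtain ⟨c, hc, hsum, hord⟩ := exists_eq_sum_pow hP hY hdeg hgen hπ0 hπ f
      have hc0 : ∀ i, 0 ≤ (c i).order := by
        intro i
        by_cases hci : c i = 0
        · simp [hci]
        · have h1 := hf.trans (hord i hci)
          have h2 : (0 : ℚ) ≤ (c i).order + (i : ℕ) * (ψ π).order := by exact_mod_cast h1
          have hKint : IntermediateField.adjoin k {xSeries k} ≤ intSupport k := by
            rw [adjoin_simple_le_iff]
            exact xSeries_mem_intSupport k
          obtain ⟨j, hj⟩ := exists_order_eq_intCast (hKint (hc i))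
          rw [hj] at h2 ⊢
          have h3 : ((i : ℕ) : ℚ) * (ψ π).order < 1 := by
            have hi : ((i : ℕ) : ℚ) < D := by exact_mod_cast i.2
            have hpos : 0 < (ψ π).order := by
              by_contra h
              nlinarith
            calc _ < D * (ψ π).order := mul_lt_mul_of_pos_right hi hpos
              _ = 1 := hπ
          have h4 : (-1 : ℚ) < j := by linarith
          have h5 : (-1 : ℤ) < j := by exact_mod_cast h4
          have h6 : 0 ≤ j := by omega
          exact_mod_cast h6
      choose e he hwe using fun i => exists_integral_of_mem_adjoin hx (hc i) (hc0 i)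
      refine ⟨e, fun i => hwe i w hwc hQ', ψ.injective ?_⟩
      change ψ f = ψ _
      rw [hsum, map_sum]
      exact Finset.sum_congr rfl fun i _ => by rw [map_mul, map_pow, he]
    have hψπ : ψ π ≠ 0 := (_root_.map_ne_zero ψ).2 hπ0
    have hπpos : 0 ≤ (ψ π).order := by
      by_contra h
      nlinarith
    -- Expanding π^D in the lower powers of π gives an integral equation for π.
    have hwπ : w π ≤ 1 := by
      by_contra! hlt
      obtain ⟨e, he, hsum⟩ := hwle (π ^ D) (by
        rw [map_pow, zero_le_orderTop_iff, order_pow]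
        positivity)
      have h1 : w (π ^ D) < w π ^ D := by
        rw [hsum]
        refine w.map_sum_lt (pow_pos (zero_lt_one.trans hlt) D).ne' fun i _ => ?_
        rw [map_mul, map_pow]
        calc w (e i) * w π ^ (i : ℕ) ≤ 1 * w π ^ (i : ℕ) := by gcongr; exact he i
          _ < w π ^ D := by rw [one_mul]; exact pow_lt_pow_right₀ hlt i.2
      rw [map_pow] at h1
      exact h1.false
    have hwv : v = w := by
      refine eq_of_le_one hsurj hws fun f hf => ?_
      by_cases hf0 : f = 0
      · rw [hf0, map_zero]; exact zero_le
      obtain ⟨e, he, hsum⟩ := hwle f (by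
        rw [zero_le_orderTop_iff]
        obtain ⟨j, hj⟩ := exists_natDegree_mul_order_eq hP hY hdeg hgen f
        rw [hvapp f hf0 j hj, ← WithZero.exp_zero, WithZero.exp_le_exp] at hf
        have : (0 : ℚ) ≤ j := by exact_mod_cast (by omega : (0 : ℤ) ≤ j)
        rw [← hj] at this
        by_contra h
        nlinarith)
      rw [hsum]
      refine w.map_sum_le fun i _ => ?_
      rw [map_mul, map_pow]
      exact mul_le_one₀ (he i) zero_le (pow_le_one₀ zero_le hwπ)
    subst hwv
    rfl

end Places

/-! ### Pole orders of y and Z -/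

section Poles

variable {k E : Type*} [Field k] [Field E] [Algebra k E] {p e q n r s : ℕ} [Fact p.Prime]
  [CharP k p] {gs : k[X]} {x y : E}

theorem valuation_y_of_one_lt (hq1 : 1 < q) (hr0 : 0 < r) (hrn : r < n)
    (hgm : gs.Monic)
    (hxy : aeval y gs = x ^ (q ^ n + q ^ (n - r)) - x ^ (q ^ (n - r) + 1))
    (w : Valuation E ℤᵐ⁰) (hw : ∀ c : k, c ≠ 0 → w (algebraMap k E c) = 1) (hx : 1 < w x) :
    1 < w y ∧ w y ^ gs.natDegree = w x ^ (q ^ n + q ^ (n - r)) := by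
  have hq0 : 0 < q := by omega
  have hF : w (aeval y gs) = w x ^ (q ^ n + q ^ (n - r)) := by
    have h1 : q ^ (n - r) + 1 < q ^ n + q ^ (n - r) := by
      have := Nat.one_lt_pow (by omega : n ≠ 0) hq1
      omega
    rw [hxy, Valuation.map_sub_eq_of_lt_left, map_pow]
    rw [map_pow, map_pow]
    exact pow_lt_pow_right₀ hx h1
  have hy : 1 < w y := by
    by_contra! h
    have h1 := valuation_aeval_le_one w hw h gs
    rw [hF] at h1
    have h2 : 0 < q ^ n := pow_pos hq0 n
    exact (one_lt_pow₀ hx (by omega)).not_ge h1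
  exact ⟨hy, by rw [← hF, valuation_aeval_of_one_lt w hw hy hgm.ne_zero]⟩

theorem valuation_y_le_one (hgm : gs.Monic) (hgpos : 0 < gs.natDegree)
    (hxy : aeval y gs = x ^ (q ^ n + q ^ (n - r)) - x ^ (q ^ (n - r) + 1))
    (w : Valuation E ℤᵐ⁰) (hw : ∀ c : k, c ≠ 0 → w (algebraMap k E c) = 1) (hx : w x ≤ 1) :
    w y ≤ 1 := by
  by_contra! hy
  have h1 := valuation_aeval_of_one_lt w hw hy hgm.ne_zero
  rw [hxy] at h1
  have h2 := w.map_sub (x ^ (q ^ n + q ^ (n - r))) (x ^ (q ^ (n - r) + 1))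
  rw [h1, map_pow, map_pow] at h2
  exact (one_lt_pow₀ hy hgpos.ne').not_ge
    (h2.trans (max_le (pow_le_one₀ zero_le hx) (pow_le_one₀ zero_le hx)))

theorem valuation_lt_y_of_one_lt (hq1 : 1 < q) (hr0 : 0 < r) (hrn : r < n) (hsn : s < n)
    (hgm : gs.Monic) (hdeg : gs.natDegree = q ^ s)
    (hxy : aeval y gs = x ^ (q ^ n + q ^ (n - r)) - x ^ (q ^ (n - r) + 1))
    (w : Valuation E ℤᵐ⁰) (hw : ∀ c : k, c ≠ 0 → w (algebraMap k E c) = 1) (hx : 1 < w x) :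
    w x < w y := by
  have hq0 : 0 < q := by omega
  obtain ⟨-, h⟩ := valuation_y_of_one_lt hq1 hr0 hrn hgm hxy w hw hx
  refine lt_of_pow_lt_pow_left₀ (q ^ s) zero_le ?_
  rw [← hdeg, h, hdeg]
  refine pow_lt_pow_right₀ hx ?_
  exact (Nat.pow_lt_pow_right hq1 hsn).trans_le (Nat.le_add_right _ _)

/-- By additivity of U and the curve equation, U(gs(y)) splits as U(x^(q^n+q^(n-r))) -
U(x^(q^(n-r)+1)), and h was chosen to remove the first term. -/
theorem IsKeyTriple.pow_eq (hq : q = p ^ e) {Q U h : k[X]} {u : ℕ}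
    (hxy : aeval y gs = x ^ (q ^ n + q ^ (n - r)) - x ^ (q ^ (n - r) + 1))
    (ht : IsKeyTriple q n r gs Q U u) (hh : IsRootPoly q n r U h) :
    (aeval y Q - aeval x h) ^ q ^ (n - r) = y - aeval (x ^ (q ^ (n - r) + 1)) U := by
  have hE : CharP E p := charP_of_injective_algebraMap (algebraMap k E).injective p
  have h1 : ∀ a b : E, (a - b) ^ q ^ (n - r) = a ^ q ^ (n - r) - b ^ q ^ (n - r) := fun a b => by
    rw [hq, ← pow_mul, sub_pow_char_pow]
  have h2 := congrArg (aeval y) ht.eq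
  have h3 := congrArg (aeval x) hh
  rw [map_pow, map_add, aeval_X, aeval_comp, hxy, ht.qpoly_U.aeval_sub hq] at h2
  rw [map_pow, aeval_comp, map_pow, aeval_X] at h3
  rw [h1, h2, h3]
  ring

theorem pow_mul_succ_lt (hq1 : 1 < q) (hrn : r < n) {m : ℕ} (h : m + 1 ≤ r) :
    q ^ m * (q ^ (n - r) + 1) < q ^ n + q ^ (n - r) := by
  have hq0 : 0 < q := by omega
  have h1 : q ^ m * (q ^ (n - r) + 1) ≤ q ^ (r - 1) * (q ^ (n - r) + 1) :=
    Nat.mul_le_mul_right _ (Nat.pow_le_pow_right hq0 (by omega))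
  have h2 : q ^ (r - 1) * q ^ (n - r) = q ^ (n - 1) := by
    rw [← pow_add]
    congr 1
    omega
  have h3 : q ^ (r - 1) ≤ q ^ (n - 1) := Nat.pow_le_pow_right hq0 (by omega)
  have h4 : q ^ n = q ^ (n - 1) * q := by
    rw [← pow_succ]
    congr 1
    omega
  have h5 : q ^ (n - 1) * 2 ≤ q ^ (n - 1) * q := Nat.mul_le_mul_left _ hq1
  have h6 : 0 < q ^ (n - r) := pow_pos hq0 _
  rw [mul_add (q ^ (r - 1)), h2, mul_one] at h1
  omega

theorem lt_pow_mul_succ (hq1 : 1 < q) (hrn : r < n) (hnr : n - r < r) {m : ℕ} (h : r ≤ m) :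
    q ^ n + q ^ (n - r) < q ^ m * (q ^ (n - r) + 1) := by
  have hq0 : 0 < q := by omega
  have h1 : q ^ r * (q ^ (n - r) + 1) ≤ q ^ m * (q ^ (n - r) + 1) :=
    Nat.mul_le_mul_right _ (Nat.pow_le_pow_right hq0 h)
  have h2 : q ^ r * q ^ (n - r) = q ^ n := by rw [← pow_add, Nat.add_sub_cancel' hrn.le]
  have h3 := Nat.pow_lt_pow_right hq1 hnr
  rw [mul_add, h2] at h1
  omega

theorem exp_pow_natCast (a b : ℕ) :
    (WithZero.exp (a : ℤ)) ^ b = WithZero.exp (((a * b : ℕ) : ℤ)) := by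
  rw [← WithZero.exp_nsmul]
  congr 1
  rw [nsmul_eq_mul]
  push_cast
  ring

/-- In `IsKeyTriple.pow_eq` the term y dominates when s + u < r and the term in U otherwise. Taking
q^(n-r)-th roots of the value gives the pole order of Z. -/
theorem valuation_Z (hq : q = p ^ e) (hq1 : 1 < q) (hr0 : 0 < r) (hrn : r < n) (hnr : n - r < r)
    (hgm : gs.Monic) (hdeg : gs.natDegree = q ^ s)
    (hxy : aeval y gs = x ^ (q ^ n + q ^ (n - r)) - x ^ (q ^ (n - r) + 1))
    (w : Valuation E ℤᵐ⁰) (hw : ∀ c : k, c ≠ 0 → w (algebraMap k E c) = 1)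
    (hx : w x = WithZero.exp ((q ^ s : ℕ) : ℤ)) {Q U h : k[X]} {u : ℕ}
    (ht : IsKeyTriple q n r gs Q U u) (hh : IsRootPoly q n r U h) :
    (s + u + 1 ≤ r → w (aeval y Q - aeval x h) = WithZero.exp ((q ^ r + 1 : ℕ) : ℤ)) ∧
      (r ≤ s + u → w (aeval y Q - aeval x h) =
        WithZero.exp ((q ^ (s + u + r - n) * (q ^ (n - r) + 1) : ℕ) : ℤ)) := by
  have hq0 : 0 < q := by omega
  have hqs : 0 < q ^ s := pow_pos hq0 s
  have hqr : q ^ (n - r) ≠ 0 := (pow_pos hq0 _).ne'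
  have hx1 : 1 < w x := by
    rw [hx, ← WithZero.exp_zero, WithZero.exp_lt_exp]
    exact_mod_cast hqs
  obtain ⟨hy1, hy⟩ := valuation_y_of_one_lt hq1 hr0 hrn hgm hxy w hw hx1
  have hwy : w y = WithZero.exp ((q ^ n + q ^ (n - r) : ℕ) : ℤ) := by
    rw [hdeg, hx, exp_pow_natCast] at hy
    refine (pow_left_inj₀ zero_le zero_le hqs.ne').1 ?_
    rw [hy, exp_pow_natCast, mul_comm]
  have hU0 : U ≠ 0 := by
    rintro rfl
    have := ht.natDegree_U
    rw [natDegree_zero] at this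
    exact (pow_pos hq0 u).ne this
  have hwU : w (aeval (x ^ (q ^ (n - r) + 1)) U) =
      WithZero.exp ((q ^ (s + u) * (q ^ (n - r) + 1) : ℕ) : ℤ) := by
    rw [valuation_aeval_of_one_lt w hw _ hU0, map_pow, hx, exp_pow_natCast, exp_pow_natCast,
      ht.natDegree_U]
    · congr 2
      rw [pow_add]
      ring
    · rw [map_pow]
      exact one_lt_pow₀ hx1 (by omega)
  have hZ := congrArg w (ht.pow_eq hq hxy hh)
  rw [map_pow] at hZ
  refine ⟨fun hc => ?_, fun hc => ?_⟩
  · have hlt : w (aeval (x ^ (q ^ (n - r) + 1)) U) < w y := by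
      rw [hwy, hwU, WithZero.exp_lt_exp]
      exact_mod_cast pow_mul_succ_lt hq1 hrn hc
    rw [Valuation.map_sub_eq_of_lt_left w hlt, hwy] at hZ
    refine (pow_left_inj₀ zero_le zero_le hqr).1 ?_
    rw [hZ, exp_pow_natCast]
    congr 2
    rw [add_mul, one_mul, ← pow_add, Nat.add_sub_cancel' hrn.le]
  · have hlt : w y < w (aeval (x ^ (q ^ (n - r) + 1)) U) := by
      rw [hwy, hwU, WithZero.exp_lt_exp]
      exact_mod_cast lt_pow_mul_succ hq1 hrn hnr hc
    rw [Valuation.map_sub_eq_of_lt_right w hlt, hwU] at hZ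
    refine (pow_left_inj₀ zero_le zero_le hqr).1 ?_
    rw [hZ, exp_pow_natCast]
    congr 2
    rw [mul_right_comm, ← pow_add]
    congr 2
    omega

theorem poleDivisor_eq_single {f : E} {P₀ : Place k E} {c : ℕ}
    (h₀ : P₀.val f = WithZero.exp (c : ℤ)) (h : ∀ P : Place k E, P ≠ P₀ → P.val f ≤ 1) :
    poleDivisor k f = Finsupp.single P₀ (c : ℤ) := by
  funext P
  rw [poleDivisor, Place.ord, neg_neg]
  by_cases hP : P = P₀
  · rw [hP, h₀, WithZero.log_exp, Finsupp.single_eq_same]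
    exact max_eq_right (Int.natCast_nonneg c)
  · rw [Finsupp.single_eq_of_ne hP]
    refine max_eq_left ?_
    -- If f has value 0, the convention log 0 = 0 gives no pole.
    by_cases h0 : P.val f = 0
    · rw [h0, WithZero.log_zero]
    · have := h P hP
      rwa [← WithZero.exp_log h0, ← WithZero.exp_zero, WithZero.exp_le_exp] at this

end Poles

/-! ### The function field of the curve inside Hahn series -/

section FunctionField

variable {k : Type*} [Field k] {q n r : ℕ} {gs : k[X]}

theorem curvePoly_monic (hgm : gs.Monic) (hgpos : 0 < gs.natDegree) :
    (curvePoly q n r gs).Monic := by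
  refine (hgm.map _).sub_of_left (degree_C_le.trans_lt ?_)
  rw [← natDegree_pos_iff_degree_pos, hgm.natDegree_map]
  exact hgpos

theorem natDegree_curvePoly (hgm : gs.Monic) :
    (curvePoly q n r gs).natDegree = gs.natDegree := by
  rw [curvePoly, natDegree_sub_C, hgm.natDegree_map]

theorem eval₂_curvePoly {Y : HahnSeries ℚ k}
    (hY : aeval Y gs = xSeries k ^ (q ^ n + q ^ (n - r)) - xSeries k ^ (q ^ (n - r) + 1)) :
    (curvePoly q n r gs).eval₂ (aeval (xSeries k)).toRingHom Y = 0 := by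
  have h : ((aeval (R := k) (xSeries k)).toRingHom.comp C) = algebraMap k (HahnSeries ℚ k) := by
    ext a
    simp
  rw [curvePoly, eval₂_sub, eval₂_map, eval₂_C, h, ← aeval_def, hY]
  simp

theorem aeval_yFun : aeval (yFun q n r gs) gs =
    xFun q n r gs ^ (q ^ n + q ^ (n - r)) - xFun q n r gs ^ (q ^ (n - r) + 1) := by
  have h : aeval (AdjoinRoot.root (curvePoly q n r gs)) gs =
      AdjoinRoot.of (curvePoly q n r gs) (X ^ (q ^ n + q ^ (n - r)) - X ^ (q ^ (n - r) + 1)) := by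
    have h1 := AdjoinRoot.eval₂_root (curvePoly q n r gs)
    rw [curvePoly, eval₂_sub, eval₂_map, eval₂_C, sub_eq_zero] at h1
    exact h1
  rw [yFun, aeval_algebraMap_apply, h, xFun]
  simp only [map_sub, map_pow]

variable {P : k[X][X]} {Y : HahnSeries ℚ k}

theorem coordHom_algebraMap (hY : P.eval₂ (aeval (xSeries k)).toRingHom Y = 0) (c : k) :
    coordHom hY (algebraMap k (AdjoinRoot P) c) = algebraMap k (HahnSeries ℚ k) c := by
  rw [AdjoinRoot.algebraMap_eq', RingHom.comp_apply, coordHom, AdjoinRoot.lift_of]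
  exact (aeval (R := k) (xSeries k)).commutes c

theorem coordHom_mem (hY : P.eval₂ (aeval (xSeries k)).toRingHom Y = 0) (a : AdjoinRoot P) :
    coordHom hY a ∈ IntermediateField.adjoin k {xSeries k, Y} := by
  obtain ⟨g, rfl⟩ := AdjoinRoot.mk_surjective a
  rw [coordHom, AdjoinRoot.lift_mk, eval₂_eq_sum_range]
  refine sum_mem fun i _ => mul_mem ?_ (pow_mem ?_ i)
  · change aeval (xSeries k) (g.coeff i) ∈ _
    rw [aeval_eq_sum_range]
    refine sum_mem fun j _ => IntermediateField.smul_mem _ (pow_mem ?_ j)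
    exact IntermediateField.subset_adjoin k _ (Set.mem_insert _ _)
  · exact IntermediateField.subset_adjoin k _ (Set.mem_insert_of_mem _ rfl)

/-- The embedding of the function field in the Hahn series. -/
noncomputable def funFieldHom [IsDomain (AdjoinRoot P)]
    (hY : P.eval₂ (aeval (xSeries k)).toRingHom Y = 0)
    (hinj : Function.Injective (coordHom hY)) :
    FractionRing (AdjoinRoot P) →ₐ[k] HahnSeries ℚ k where
  toRingHom := IsFractionRing.lift hinj
  commutes' c := by
    change IsFractionRing.lift hinj (algebraMap k (FractionRing (AdjoinRoot P)) c) = _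
    rw [IsScalarTower.algebraMap_apply k (AdjoinRoot P), IsFractionRing.lift_algebraMap,
      coordHom_algebraMap]

theorem funFieldHom_algebraMap [IsDomain (AdjoinRoot P)]
    (hY : P.eval₂ (aeval (xSeries k)).toRingHom Y = 0)
    (hinj : Function.Injective (coordHom hY)) (a : AdjoinRoot P) :
    funFieldHom hY hinj (algebraMap _ _ a) = coordHom hY a :=
  IsFractionRing.lift_algebraMap hinj a

theorem fieldRange_funFieldHom_le [IsDomain (AdjoinRoot P)]
    (hY : P.eval₂ (aeval (xSeries k)).toRingHom Y = 0)
    (hinj : Function.Injective (coordHom hY)) :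
    (funFieldHom hY hinj).fieldRange ≤ IntermediateField.adjoin k {xSeries k, Y} := by
  rintro _ ⟨f, rfl⟩
  obtain ⟨a, b, -, rfl⟩ := IsFractionRing.div_surjective (A := AdjoinRoot P) f
  change funFieldHom hY hinj _ ∈ _
  rw [map_div₀, funFieldHom_algebraMap, funFieldHom_algebraMap]
  exact div_mem (coordHom_mem hY a) (coordHom_mem hY b)

theorem exists_unique_place_fractionRing [IsDomain (AdjoinRoot P)] (hP : P.Monic)
    (hY : P.eval₂ (aeval (xSeries k)).toRingHom Y = 0)
    (hdeg : (minpoly (intSupport k) Y).natDegree = P.natDegree) :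
    ∃ Q : Place k (FractionRing (AdjoinRoot P)),
      Q.val (algebraMap _ _ (AdjoinRoot.of P X)) = WithZero.exp (P.natDegree : ℤ) ∧
      ∀ Q' : Place k (FractionRing (AdjoinRoot P)),
        1 < Q'.val (algebraMap _ _ (AdjoinRoot.of P X)) → Q' = Q := by
  have hinj := coordHom_injective hP hY hdeg
  refine exists_unique_place (ψ := funFieldHom hY hinj) hP hY hdeg ?_
    ⟨algebraMap _ _ (AdjoinRoot.root P), ?_⟩ (fieldRange_funFieldHom_le hY hinj)
  · rw [funFieldHom_algebraMap, coordHom, AdjoinRoot.lift_of]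
    exact aeval_X _
  · change funFieldHom hY hinj _ = _
    rw [funFieldHom_algebraMap, coordHom, AdjoinRoot.lift_root]

end FunctionField

end SubcoverXnr

/-! ### The main theorem -/

open SubcoverXnr

theorem theorem3p3 {k : Type*} [Field k] [Fintype k] (q n r s : ℕ)
    (hq : IsPrimePow q) (hk : Fintype.card k = q ^ n)
    (hn : 2 ≤ n) (hr : n ≤ 2 * r) (hrn : r < n) (hnr : Nat.Coprime n r)
    (hs : 1 ≤ s) (hsn : s < n - 1)
    (gs : k[X]) (hgs : SubcoverXnr.IsCoverPoly q n s gs) :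
    -- the curve is irreducible, with a function field
    IsField (SubcoverXnr.FunField q n r gs) ∧
    -- `Q`, `U` and `u` are well defined
    (∃! t : k[X] × k[X] × ℕ, SubcoverXnr.IsKeyTriple q n r gs t.1 t.2.1 t.2.2) ∧
    -- `P_∞` is well defined
    ∃ Pinf : SubcoverXnr.Place k (SubcoverXnr.FunField q n r gs),
      (∀ P, SubcoverXnr.IsAtInfinity q n r gs P ↔ P = Pinf) ∧
      ∀ (Q U : k[X]) (u : ℕ), SubcoverXnr.IsKeyTriple q n r gs Q U u →
        (∃! h : k[X], SubcoverXnr.IsRootPoly q n r U h) ∧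
        ∀ h : k[X], SubcoverXnr.IsRootPoly q n r U h →
          (s + u + 1 ≤ r →
            SubcoverXnr.poleDivisor k (SubcoverXnr.zFun q n r gs Q h) =
              Finsupp.single Pinf ((q : ℤ) ^ r + 1)) ∧
          (r ≤ s + u →
            SubcoverXnr.poleDivisor k (SubcoverXnr.zFun q n r gs Q h) =
              Finsupp.single Pinf ((q : ℤ) ^ (s + u + r - n) * ((q : ℤ) ^ (n - r) + 1))) ∧
          (s + n ≤ 2 * r →
            SubcoverXnr.poleDivisor k (SubcoverXnr.zFun q n r gs Q h) =
              Finsupp.single Pinf ((q : ℤ) ^ r + 1)) ∧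
          (r + 1 ≤ s →
            SubcoverXnr.poleDivisor k (SubcoverXnr.zFun q n r gs Q h) =
              Finsupp.single Pinf ((q : ℤ) ^ n + (q : ℤ) ^ r)) := by
  obtain ⟨p, e, hp, he, hpe⟩ := (isPrimePow_nat_iff q).1 hq
  have : Fact p.Prime := ⟨hp⟩
  have hq' : q = p ^ e := hpe.symm
  have hq1 : 1 < q := hq.one_lt
  have hq0 : 0 < q := by omega
  have hr0 : 0 < r := by omega
  have hsn' : s < n := by omega
  have hN : 1 < q ^ n := Nat.one_lt_pow (by omega) hq1
  have hchar : CharP k p := by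
    obtain ⟨p', hp'⟩ := CharP.exists k
    have hprime : Fact p'.Prime := ⟨CharP.char_is_prime k p'⟩
    obtain ⟨m, -, hm⟩ := FiniteField.card k p'
    have hdvd : p ∣ p' ^ (m : ℕ) := by
      rw [← hm, hk, hq', ← pow_mul]
      exact dvd_pow_self p (Nat.mul_ne_zero he.ne' (by omega))
    rwa [(Nat.prime_dvd_prime_iff_eq hp hprime.out).1 (hp.dvd_of_dvd_pow hdvd)]
  -- n = 2r together with gcd(n, r) = 1 would give n = 2, leaving no s with 1 ≤ s < n - 1.
  have hnr' : n - r < r := by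
    by_contra h
    have h2 : n = 2 * r := by omega
    have h3 : r ∣ n.gcd r := Nat.dvd_gcd (h2 ▸ dvd_mul_left r 2) dvd_rfl
    rw [hnr.gcd_eq_one] at h3
    have := Nat.le_of_dvd one_pos h3
    omega
  obtain ⟨g, hgq, -, hgcomp⟩ := hgs.comp_eq
  set h := g.comp (X ^ q - X) with hdef
  have hcomp : gs.comp h = X ^ q ^ n - X := comp_comp_X_pow_sub_X hq' hgcomp
  have hh : IsQPoly q h := hgq.comp hq' isQPoly_X_pow_sub_X
  have hh1 : h.coeff 1 ≠ 0 := by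
    intro h0
    have := congrArg (fun f => coeff f 1) hcomp
    simp only [coeff_one_comp (hh.coeff_zero hq0), h0, coeff_sub, coeff_X_pow, if_neg hN.ne,
      coeff_X_one] at this
    simp at this
  have hgpos : 0 < gs.natDegree := hgs.natDegree_eq ▸ pow_pos hq0 s
  have hcomp' := comp_eq_of_comp_eq hq' hq1 hk hgs.qpoly hgpos hh hcomp
  have hdegh : h.natDegree = q ^ (n - s) := by
    have h1 := congrArg natDegree hcomp
    rw [natDegree_comp, natDegree_sub_eq_left_of_natDegree_lt (by simpa using hN),
      natDegree_X_pow, hgs.natDegree_eq] at h1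
    refine Nat.eq_of_mul_eq_mul_left (pow_pos hq0 s) ?_
    rw [h1, ← pow_add, Nat.add_sub_cancel' hsn'.le]
  have hPm := curvePoly_monic (q := q) (n := n) (r := r) hgs.monic hgpos
  have hPdeg := natDegree_curvePoly (q := q) (n := n) (r := r) hgs.monic
  have hY := eval₂_curvePoly (aeval_curveSeries_comp (r := r) hq' hN hcomp)
  have hdeg := (natDegree_minpoly hq' hq1 hN hrn hr0 hnr'.ne hgs.qpoly hgs.monic hgs.splits hh
    hcomp).trans hPdeg.symm
  have hdom : IsDomain (AdjoinRoot (curvePoly q n r gs)) :=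
    (coordHom_injective hPm hY hdeg).isDomain
  obtain ⟨Pinf, hval, huniq⟩ := exists_unique_place_fractionRing hPm hY hdeg
  have hxy := aeval_yFun (q := q) (n := n) (r := r) (gs := gs)
  rw [hPdeg, hgs.natDegree_eq] at hval
  change Pinf.val (xFun q n r gs) = _ at hval
  change ∀ Q' : Place k (FunField q n r gs), 1 < Q'.val (xFun q n r gs) → Q' = Pinf at huniq
  have hxinf : 1 < Pinf.val (xFun q n r gs) := by
    rw [hval, ← WithZero.exp_zero, WithZero.exp_lt_exp]
    exact_mod_cast pow_pos hq0 s
  have hyle : ∀ P : Place k (FunField q n r gs), P ≠ Pinf →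
      P.val (xFun q n r gs) ≤ 1 ∧ P.val (yFun q n r gs) ≤ 1 := by
    intro P hP
    have hx : P.val (xFun q n r gs) ≤ 1 := not_lt.1 fun hx => hP (huniq P hx)
    exact ⟨hx, valuation_y_le_one hgs.monic hgpos hxy P.val P.trivial_on_const hx⟩
  refine ⟨Field.toIsField (FractionRing (AdjoinRoot (curvePoly q n r gs))), ?_, Pinf,
    fun P => ⟨fun hP => ?_, ?_⟩, ?_⟩
  · obtain ⟨Q, U, u, ht⟩ := exists_isKeyTriple hq' hq1 hrn hgs.qpoly hh hh1 hcomp'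
    refine ⟨(Q, U, u), ht, ?_⟩
    rintro ⟨Q', U', u'⟩ ht'
    obtain ⟨rfl, rfl, rfl⟩ := IsKeyTriple.ext hq' hq1 hrn hh hcomp ht ht'
    rfl
  -- Away from `Pinf` the function y is integral, so no other place is centred at infinity.
  · by_contra hne
    exact hP.2.not_ge (hyle P hne).2
  · rintro rfl
    exact ⟨valuation_lt_y_of_one_lt hq1 hr0 hrn hsn' hgs.monic hgs.natDegree_eq hxy P.val
      P.trivial_on_const hxinf, (valuation_y_of_one_lt hq1 hr0 hrn hgs.monic hxy P.val
      P.trivial_on_const hxinf).1⟩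
  · intro Q U u ht
    refine ⟨existsUnique_isRootPoly hq' hq0 U, fun f hf => ?_⟩
    obtain ⟨hZ1, hZ2⟩ := valuation_Z hq' hq1 hr0 hrn hnr' hgs.monic hgs.natDegree_eq hxy Pinf.val
      Pinf.trivial_on_const hval ht hf
    have hle : ∀ P : Place k (FunField q n r gs), P ≠ Pinf → P.val (zFun q n r gs Q f) ≤ 1 := by
      intro P hP
      obtain ⟨hx, hy⟩ := hyle P hP
      exact (P.val.map_sub _ _).trans (max_le
        (valuation_aeval_le_one P.val P.trivial_on_const hy Q)
        (valuation_aeval_le_one P.val P.trivial_on_const hx f))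
    have h1 : s + u + 1 ≤ r → poleDivisor k (zFun q n r gs Q f) =
        Finsupp.single Pinf ((q : ℤ) ^ r + 1) := by
      intro hc
      have := poleDivisor_eq_single (hZ1 hc) hle
      push_cast at this
      exact this
    have h2 : r ≤ s + u → poleDivisor k (zFun q n r gs Q f) =
        Finsupp.single Pinf ((q : ℤ) ^ (s + u + r - n) * ((q : ℤ) ^ (n - r) + 1)) := by
      intro hc
      have := poleDivisor_eq_single (hZ2 hc) hle
      push_cast at this
      exact this
    refine ⟨h1, h2, fun hc => h1 ?_, fun hc => ?_⟩
    -- u ≤ n - r - 1 and s ≤ 2r - n give s + u + 1 ≤ r.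
    · have := ht.u_le
      omega
    -- Here u = n - s, so s + u = n and the exponent s + u + r - n is r.
    · have hu := ht.u_eq hq' hq1 hrn hh hcomp hdegh hc hsn'
      rw [h2 (by omega), mul_add, ← pow_add, mul_one]
      rw [show s + u + r - n + (n - r) = n by omega, show s + u + r - n = r by omega]
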